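/- Setting. A set $\mathcal M$ of $m\ge 1$ indivisible items is to be divided among $n\ge 2$ agents. An allocation is a partition $(A_1,\dots,A_n)$ of $\mathcal M$ into $n$ (possibly empty) bundles. For an ordering $\pi = g_1\succ g_2\succ\dots\succ g_m$ of the items and bundles $A,B\subseteq\mathcal M$ write $A\succeq^{\mathrm{sd}}_\pi B$ if $|A|\ge |B|$ and, for every $k\le |B|$, the position in $\pi$ of the $k$-th best item of $A$ is at most the position of the $k$-th best item of $B$. A valuation $v:2^{\mathcal M}\to\mathbb R$ is order-consistent with respect to $\pi$ if $A\succeq^{\mathrm{sd}}_\pi B$ implies $v(A)\ge v(B)$; it is order-consistent if this holds for some $\pi$. An allocation is EF (respectively EFX) for valuations $u_1,\dots,u_n$ if $u_i(A_i)\ge u_i(A_j)$ for all $i,j$ (respectively $u_i(A_i)\ge u_i(A_j\setminus\{g\})$ for all $i,j$ and all $g\in A_j$). It is SD-EF (respectively SD-EFX) for orderings $\tau_1,\dots,\tau_n$ if $A_i\succeq^{\mathrm{sd}}_{\tau_i}A_j$ for all $i,j$ (respectively $A_i\succeq^{\mathrm{sd}}_{\tau_i}A_j\setminus\{g\}$ for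 all $i,j$ and all $g\in A_j$). Round-Robin lets the agents pick in the order $1,\dots,n,1,\dots,n,\dots$ until no item is left; whoever picks takes the remaining item that is first in her ordering. Let agent $i$ have a valuation $v_i$ that is order-consistent with respect to an ordering $\sigma_i$, all chosen arbitrarily, and let $\rho_1,\dots,\rho_n$ be independent uniformly random permutations of $\mathcal M$ (renamings). After renaming, agent $i$ has the valuation $v_i^{\rho_i}(S)=v_i(\rho_i^{-1}(S))$ and the ordering $\pi_i=\rho_i\circ\sigma_i$, in which the $k$-th item is $\rho_i$ of the $k$-th item of $\sigma_i$. Round-Robin is run on $\pi_1,\dots,\pi_n$, SD-EF and SD-EFX refer to $\pi_1,\dots,\pi_n$, and EF and EFX refer to the $v_i^{\rho_i}$. Theorem. There are absolute constants $C,c>0$ (in particular independent of $n$, $m$, the $v_i$ and the $\sigma_i$) such that the following hold for all $n\ge 2$ and $m\ge 1$. 1. If $n$ divides $m$, then for all such $v_i,\sigma_i$ the allocation output by Round-Robin is SD-EF (and, in particular, EF) with probability at least $$1-C\left(\frac{n^2}{m}+\frac{n\log m}{m^{(n-1)/n}}\right),$$ where $\log$ is the natural logarithm. 2. For every $m$ and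 all such $v_i,\sigma_i$, the allocation output by Round-Robin is SD-EFX (and, in particular, EFX) with probability at least $1-C\,\frac{n^2}{m}$. 3. If $m\ge 2n$ (whether or not $n$ divides $m$), then (a) there are order-consistent valuations for which, with probability at least $c\min\left(\frac{n^2}{m},1\right)$, no EF allocation exists: this is so for every choice of unit-demand valuations $v_i(S)=\max_{g\in S}w_{i,g}$, $v_i(\emptyset)=0$, with item values $w_{i,g}\ge 0$ such that each agent has a unique most valuable item, and such valuations are order-consistent; and (b) for every choice of the $\sigma_i$, with probability at least $c\min\left(\frac{n^2}{m},1\right)$ no SD-EFX allocation exists. -/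

import Mathlib

namespace FairDivision

/-- An allocation of the `m` items to the `n` agents: a partition of the items into `n` (possibly
empty) bundles, one for each agent. All items are allocated. -/
structure Allocation (n m : ℕ) where
  bundle : Fin n → Finset (Fin m)
  disjoint : ∀ i j, i ≠ j → Disjoint (bundle i) (bundle j)
  cover : ∀ g, ∃ i, g ∈ bundle i

/-- A valuation assigns a real value to every bundle. -/
abbrev BundleValuation (m : ℕ) := Finset (Fin m) → ℝ

/-- An ordering `g₁ ≻ g₂ ≻ ⋯ ≻ gₘ` of the items, as the bijection that sends a position to the item
in that position; position `0` is the best one. -/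
abbrev ItemOrder (m : ℕ) := Equiv.Perm (Fin m)

/-- The set of positions that the items of `A` have in the ordering `π`. -/
def positions {m : ℕ} (π : ItemOrder m) (A : Finset (Fin m)) : Finset (Fin m) :=
  A.map π.symm.toEmbedding

/-- For sets `P`, `Q` of positions: `|P| ≥ |Q|` and for every `k < |Q|` the `k`-th smallest element of
`P` is at most the `k`-th smallest element of `Q`. -/
def PositionsGe {m : ℕ} (P Q : Finset (Fin m)) : Prop :=
  ∃ h : Q.card ≤ P.card, ∀ k : Fin Q.card,
    P.orderEmbOfFin rfl (Fin.castLE h k) ≤ Q.orderEmbOfFin rfl k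

/-- `A ⪰ˢᵈ_π B`: `A` has at least as many items as `B`, and for every `k ≤ |B|` the position in `π` of
the `k`-th best item of `A` is at most that of the `k`-th best item of `B`. -/
def SDGe {m : ℕ} (π : ItemOrder m) (A B : Finset (Fin m)) : Prop :=
  PositionsGe (positions π A) (positions π B)

/-- The valuation `v` is order-consistent with respect to the ordering `π`. -/
def OrderConsistentWith {m : ℕ} (π : ItemOrder m) (v : BundleValuation m) : Prop :=
  ∀ A B : Finset (Fin m), SDGe π A B → v B ≤ v A

/-- The valuation `v` is order-consistent with respect to some ordering. -/
def OrderConsistent {m : ℕ} (v : BundleValuation m) : Prop :=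
  ∃ π : ItemOrder m, OrderConsistentWith π v

/-- The valuation `v^ρ`, `v^ρ(S) = v(ρ⁻¹(S))`, obtained from `v` by renaming the items by `ρ`. -/
def rename {m : ℕ} (ρ : Equiv.Perm (Fin m)) (v : BundleValuation m) : BundleValuation m :=
  fun S => v (S.map ρ.symm.toEmbedding)

/-- The ordering obtained from `σ` by renaming the items by `ρ`: the item in position `k` is
`ρ (σ k)`. -/
def renameOrdering {m : ℕ} (ρ : Equiv.Perm (Fin m)) (σ : ItemOrder m) : ItemOrder m :=
  σ.trans ρ

/-- The unit-demand valuation with item values `w`: the value of a non-empty bundle is the largest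
value of an item in it, and the empty bundle is worth `0`. -/
noncomputable def unitDemand {m : ℕ} (w : Fin m → ℝ) : BundleValuation m :=
  fun S => if h : S.Nonempty then S.sup' h w else 0

variable {n m : ℕ}

/-- Envy-freeness. -/
def Allocation.IsEF (A : Allocation n m) (v : Fin n → BundleValuation m) : Prop :=
  ∀ i j, v i (A.bundle j) ≤ v i (A.bundle i)

/-- Envy-freeness up to any good. -/
def Allocation.IsEFX (A : Allocation n m) (v : Fin n → BundleValuation m) : Prop :=
  ∀ i j, ∀ g ∈ A.bundle j, v i ((A.bundle j).erase g) ≤ v i (A.bundle i)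

/-- SD-envy-freeness with respect to the agents' orderings `π`. -/
def Allocation.IsSDEF (A : Allocation n m) (π : Fin n → ItemOrder m) : Prop :=
  ∀ i j, SDGe (π i) (A.bundle i) (A.bundle j)

/-- SD-envy-freeness up to any item with respect to the agents' orderings `π`. -/
def Allocation.IsSDEFX (A : Allocation n m) (π : Fin n → ItemOrder m) : Prop :=
  ∀ i j, ∀ g ∈ A.bundle j, SDGe (π i) (A.bundle i) ((A.bundle j).erase g)

/-- The item of the non-empty pool `P` that comes first in the ordering `π`. -/
def best (π : ItemOrder m) (P : Finset (Fin m)) (hP : P.Nonempty) : Fin m :=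
  π ((positions π P).min' (Finset.map_nonempty.2 hP))

theorem best_mem (π : ItemOrder m) (P : Finset (Fin m)) (hP : P.Nonempty) : best π P hP ∈ P := by
  have h := (positions π P).min'_mem (Finset.map_nonempty.2 hP)
  obtain ⟨g, hg, e⟩ := Finset.mem_map.1 h
  unfold best
  rw [← e]
  simpa using hg

/-- The state of Round-Robin after `t` picks: the bundles so far and the pool of unallocated items.
Agents are numbered `0, …, n - 1`; pick number `t` (counted from `0`) is made by agent `t mod n`,
who takes the first item of the pool in her ordering. -/
def rrState [NeZero n] (π : Fin n → ItemOrder m) :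
    ℕ → (Fin n → Finset (Fin m)) × Finset (Fin m)
  | 0 => (fun _ => ∅, Finset.univ)
  | t + 1 =>
    let s := rrState π t
    let i : Fin n := Fin.ofNat n t
    if hP : s.2.Nonempty then
      (Function.update s.1 i (insert (best (π i) s.2 hP) (s.1 i)), s.2.erase (best (π i) s.2 hP))
    else s

theorem rrState_invariant [NeZero n] (π : Fin n → ItemOrder m) (t : ℕ) :
    (∀ i j, i ≠ j → Disjoint ((rrState π t).1 i) ((rrState π t).1 j)) ∧
    (∀ i, Disjoint ((rrState π t).1 i) (rrState π t).2) ∧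
    (∀ g, g ∈ (rrState π t).2 ∨ ∃ i, g ∈ (rrState π t).1 i) ∧
    (rrState π t).2.card = m - t := by
  induction t with
  | zero => simp [rrState]
  | succ t ih =>
    obtain ⟨h1, h2, h3, h4⟩ := ih
    by_cases hP : (rrState π t).2.Nonempty
    · have hb := best_mem (π (Fin.ofNat n t)) _ hP
      simp only [rrState, dif_pos hP]
      generalize best (π (Fin.ofNat n t)) _ hP = b at hb
      generalize Fin.ofNat n t = a
      refine ⟨?_, ?_, ?_, ?_⟩
      · intro i j hij
        have hd := h1 i j hij
        have hi := h2 i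
        have hj := h2 j
        rw [Finset.disjoint_left] at *
        intro x hx hy
        by_cases ei : i = a <;> by_cases ej : j = a <;> simp_all <;> grind
      · intro i
        have hi := h2 i
        rw [Finset.disjoint_left] at *
        intro x hx
        by_cases ei : i = a <;> simp_all <;> grind
      · intro g
        by_cases hgb : g = b
        · right; exact ⟨a, by simp [hgb]⟩
        · rcases h3 g with hg | ⟨i, hg⟩
          · left; simp [hgb, hg]
          · right
            refine ⟨i, ?_⟩
            by_cases ei : i = a
            · subst ei; simp [hg]
            · simp [ei, hg]
      · rw [Finset.card_erase_of_mem hb, h4]; omega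
    · simp only [rrState, dif_neg hP]
      refine ⟨h1, h2, h3, ?_⟩
      rw [Finset.not_nonempty_iff_eq_empty] at hP
      rw [hP] at h4 ⊢
      simp at h4 ⊢
      omega

/-- The allocation that Round-Robin outputs on the orderings `π`, after all `m` picks. -/
def roundRobin [NeZero n] (π : Fin n → ItemOrder m) : Allocation n m where
  bundle := (rrState π m).1
  disjoint := (rrState_invariant π m).1
  cover := fun g => by
    obtain ⟨-, -, h, hc⟩ := rrState_invariant π m
    rcases h g with hg | hg
    · have : 0 < (rrState π m).2.card := Finset.card_pos.2 ⟨g, hg⟩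
      omega
    · exact hg

open Classical in
/-- The probability of the event `E` when the renamings `ρ₁, …, ρₙ` of the `m` items are
independent and uniformly random, that is, when `(ρ₁, …, ρₙ)` is uniform over all `(m!)ⁿ`
tuples of permutations. -/
noncomputable def renamingProb (n m : ℕ) (E : (Fin n → Equiv.Perm (Fin m)) → Prop) : ℝ :=
  ((Finset.univ.filter E).card : ℝ) / (Fintype.card (Fin n → Equiv.Perm (Fin m)) : ℝ)

end FairDivision

open FairDivision

namespace FairDivision

/-! ### Bookkeeping for Round-Robin: pool, bundles and their sizes -/

section RoundRobin

variable {n m : ℕ}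

/-! Suppose that agent `i` does not SD-dominate agent `j`. Then some prefix of `i`'s ordering
contains more of `j`'s items than of `i`'s own, say `c` of the latter. At pick number `c` of agent
`i` (counted from 0) the prefix must be exhausted, so `j` precedes `i`, and the `c + 1` items that
`j` holds all come before every unallocated item in `i`'s ordering. This is `EnvyAt`, and
`envyAt_of_card_lt` extracts it. For SD-EFX the last pick of the whole run is harmless, which is why
its bound has no logarithmic term.

To bound the probability of `EnvyAt`, fix the other orderings and reveal `i`'s ordering one position
at a time; the next item is uniform among those not yet revealed. An item of the pool becomes `i`'s
pick, and one round later `j` holds one more unrevealed item; an unrevealed item of `j` lowers their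
number by one; any other item changes nothing. With `R` items left at the target turn, `d` rounds to
go and `Y` unrevealed items of `j`, the pool has `R + d n` items and the probability `p` satisfies
`(R + d n + Y) p(d, Y) = (R + d n) p(d - 1, Y + 1) + Y p(d, Y - 1)`. The explicit function
`envyBound` is a supersolution of this recursion; `card_filter_cyl_envyAt_le` is the induction.

A union bound over turns and over `j` leaves a sum (`sum_envyBound_le`): early turns decay
geometrically in the round number, late turns with at least six items left decay cubically, and a
bounded number of turns remains. The last turn alone contributes order `n² / m ^ ((n - 1) / n)`
after the union bound, which `sq_div_rpow_le` absorbs into the stated error. If `m < n²`, the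
positive claims are void.

For the negative claims, two agents with the same favourite item already rule out a fair allocation,
and by the birthday bound (`min_le_renamingProb_not_injective`) such a collision has probability of
order `min (n² / m) 1`. -/

theorem best_position_le (π : ItemOrder m) (P : Finset (Fin m)) (hP : P.Nonempty) {g : Fin m}
    (hg : g ∈ P) : π.symm (best π P hP) ≤ π.symm g := by
  unfold best
  rw [Equiv.symm_apply_apply]
  exact Finset.min'_le _ _ (Finset.mem_map.2 ⟨g, hg, rfl⟩)

theorem best_eq_of_forall_le (π : ItemOrder m) (P : Finset (Fin m)) (hP : P.Nonempty) {x : Fin m}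
    (hx : x ∈ P) (h : ∀ g ∈ P, π.symm x ≤ π.symm g) : best π P hP = x :=
  π.symm.injective (le_antisymm (best_position_le π P hP hx) (h _ (best_mem π P hP)))

/-- This makes `(t + (n - 1 - i)) / n`, the bundle size in `rrBundle_card`, jump exactly at the
turns of agent `i`. -/
theorem dvd_turn_iff (t : ℕ) (i : Fin n) : n ∣ t + (n - 1 - i) + 1 ↔ t % n = i := by
  have hi := i.2
  have e : t + (n - 1 - i) + 1 = t + (n - i) := by omega
  have hn : 0 < n := by omega
  rw [e]
  constructor
  · rintro ⟨q, hq⟩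
    have : t + n = n * q + i := by omega
    have h2 := congrArg (· % n) this
    simpa [Nat.mod_eq_of_lt hi] using h2
  · intro h
    have := Nat.div_add_mod t n
    refine ⟨t / n + 1, ?_⟩
    rw [mul_add]; omega

variable [NeZero n]

/-- The bundle of agent `i` after `t` picks of Round-Robin. -/
abbrev rrBundle (π : Fin n → ItemOrder m) (t : ℕ) (i : Fin n) : Finset (Fin m) :=
  (rrState π t).1 i

/-- The unallocated items after `t` picks of Round-Robin. -/
abbrev rrPool (π : Fin n → ItemOrder m) (t : ℕ) : Finset (Fin m) := (rrState π t).2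

variable (π : Fin n → ItemOrder m)

theorem rrPool_card (t : ℕ) : (rrPool π t).card = m - t := (rrState_invariant π t).2.2.2

theorem rrPool_nonempty {t : ℕ} (ht : t < m) : (rrPool π t).Nonempty := by
  rw [← Finset.card_pos, rrPool_card]; omega

theorem rrBundle_disjoint_rrPool (t : ℕ) (i : Fin n) : Disjoint (rrBundle π t i) (rrPool π t) :=
  (rrState_invariant π t).2.1 i

theorem rrState_succ_of_nonempty {t : ℕ} (hP : (rrPool π t).Nonempty) :
    rrState π (t + 1) =
      (Function.update (rrState π t).1 (Fin.ofNat n t)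
        (insert (best (π (Fin.ofNat n t)) (rrPool π t) hP) (rrBundle π t (Fin.ofNat n t))),
       (rrPool π t).erase (best (π (Fin.ofNat n t)) (rrPool π t) hP)) := by
  simp only [rrState]
  rw [dif_pos hP]

theorem rrState_succ_of_empty {t : ℕ} (hP : ¬ (rrPool π t).Nonempty) :
    rrState π (t + 1) = rrState π t := by
  simp only [rrState]
  rw [dif_neg hP]

theorem rrPool_succ_subset (t : ℕ) : rrPool π (t + 1) ⊆ rrPool π t := by
  by_cases hP : (rrPool π t).Nonempty
  · simp only [rrPool, rrState_succ_of_nonempty π hP]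
    exact Finset.erase_subset _ _
  · simp only [rrPool, rrState_succ_of_empty π hP]
    exact subset_rfl

theorem rrPool_antitone : Antitone (rrPool π) := antitone_nat_of_succ_le (rrPool_succ_subset π)

theorem rrBundle_succ_of_eq {t : ℕ} {i : Fin n} (hP : (rrPool π t).Nonempty)
    (hi : Fin.ofNat n t = i) :
    rrBundle π (t + 1) i = insert (best (π i) (rrPool π t) hP) (rrBundle π t i) := by
  subst hi
  simp only [rrBundle, rrState_succ_of_nonempty π hP, Function.update_self]

theorem rrBundle_succ_of_ne {t : ℕ} {i : Fin n} (hi : Fin.ofNat n t ≠ i) :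
    rrBundle π (t + 1) i = rrBundle π t i := by
  by_cases hP : (rrPool π t).Nonempty
  · simp only [rrBundle, rrState_succ_of_nonempty π hP]
    exact Function.update_of_ne (Ne.symm hi) _ _
  · simp only [rrBundle, rrState_succ_of_empty π hP]

theorem rrBundle_subset_succ (t : ℕ) (i : Fin n) : rrBundle π t i ⊆ rrBundle π (t + 1) i := by
  by_cases hi : Fin.ofNat n t = i
  · by_cases hP : (rrPool π t).Nonempty
    · rw [rrBundle_succ_of_eq π hP hi]; exact Finset.subset_insert _ _
    · simp only [rrBundle, rrState_succ_of_empty π hP]; exact subset_rfl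
  · rw [rrBundle_succ_of_ne π hi]

theorem rrBundle_mono (i : Fin n) : Monotone (fun t => rrBundle π t i) :=
  monotone_nat_of_le_succ fun t => rrBundle_subset_succ π t i

theorem rrBundle_subset_union {t t' : ℕ} (h : t ≤ t') (i : Fin n) :
    rrBundle π t' i ⊆ rrBundle π t i ∪ rrPool π t := by
  induction t', h using Nat.le_induction with
  | base => exact Finset.subset_union_left
  | succ t' h ih =>
    by_cases hi : Fin.ofNat n t' = i
    · by_cases hP : (rrPool π t').Nonempty
      · rw [rrBundle_succ_of_eq π hP hi]
        refine Finset.insert_subset ?_ ih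
        exact Finset.mem_union_right _ (rrPool_antitone π h (best_mem _ _ hP))
      · simp only [rrBundle, rrState_succ_of_empty π hP]; exact ih
    · rw [rrBundle_succ_of_ne π hi]; exact ih

theorem ofNat_eq_iff_mod (t : ℕ) (i : Fin n) : Fin.ofNat n t = i ↔ t % n = i := by
  rw [Fin.ext_iff]; rfl

theorem rrBundle_card {t : ℕ} (ht : t ≤ m) (i : Fin n) :
    (rrBundle π t i).card = (t + (n - 1 - i)) / n := by
  have hi := i.2
  induction t with
  | zero =>
    have : (0 + (n - 1 - i)) / n = 0 := Nat.div_eq_of_lt (by omega)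
    rw [this]; rfl
  | succ t ih =>
    have ih := ih (by omega)
    have e : t + 1 + (n - 1 - i) = t + (n - 1 - i) + 1 := by omega
    rw [e, Nat.succ_div]
    by_cases h : Fin.ofNat n t = i
    · have hP := rrPool_nonempty π (show t < m by omega)
      rw [if_pos ((dvd_turn_iff t i).2 ((ofNat_eq_iff_mod t i).1 h)), rrBundle_succ_of_eq π hP h,
        Finset.card_insert_of_notMem, ih]
      exact Finset.disjoint_right.1 (rrBundle_disjoint_rrPool π t i) (best_mem _ _ hP)
    · rw [if_neg (fun h' => h ((ofNat_eq_iff_mod t i).2 ((dvd_turn_iff t i).1 h'))),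
        rrBundle_succ_of_ne π h, ih]
      rfl

theorem rrBundle_card_turn_of_lt {c : ℕ} {i j : Fin n} (hij : j < i) (h : c * n + i ≤ m) :
    (rrBundle π (c * n + i) j).card = c + 1 := by
  have hi := i.2
  have hj := j.2
  rw [Fin.lt_def] at hij
  rw [rrBundle_card π h]
  have : c * n + i + (n - 1 - j) = (i - 1 - j) + (c + 1) * n := by rw [add_mul]; omega
  rw [this, Nat.add_mul_div_right _ _ (by omega), Nat.div_eq_of_lt (by omega), zero_add]

theorem rrBundle_card_turn_of_le {c : ℕ} {i j : Fin n} (hij : i ≤ j) (h : c * n + i ≤ m) :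
    (rrBundle π (c * n + i) j).card = c := by
  have hi := i.2
  have hj := j.2
  rw [Fin.le_def] at hij
  rw [rrBundle_card π h]
  have : c * n + i + (n - 1 - j) = (n - 1 - j + i) + c * n := by omega
  rw [this, Nat.add_mul_div_right _ _ (by omega), Nat.div_eq_of_lt (by omega), zero_add]

/-- While an item among the first `x` positions of agent `i` is unallocated, she only takes such
items. -/
theorem position_le_of_mem_rrBundle (i : Fin n) (x : Fin m) {t : ℕ}
    (h : ∃ g ∈ rrPool π t, (π i).symm g ≤ x) : ∀ g ∈ rrBundle π (t + 1) i, (π i).symm g ≤ x := by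
  induction t with
  | zero =>
    obtain ⟨g, hg, hx⟩ := h
    by_cases hi : Fin.ofNat n 0 = i
    · have hP : (rrPool π 0).Nonempty := ⟨g, hg⟩
      rw [rrBundle_succ_of_eq π hP hi]
      intro g' hg'
      rcases Finset.mem_insert.1 hg' with rfl | hg'
      · exact (best_position_le _ _ _ hg).trans hx
      · exact absurd hg' (Finset.notMem_empty _)
    · rw [rrBundle_succ_of_ne π hi]
      intro g' hg'
      exact absurd hg' (Finset.notMem_empty _)
  | succ t ih =>
    obtain ⟨g, hg, hx⟩ := h
    have ih := ih ⟨g, rrPool_succ_subset π t hg, hx⟩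
    by_cases hi : Fin.ofNat n (t + 1) = i
    · have hP : (rrPool π (t + 1)).Nonempty := ⟨g, hg⟩
      rw [rrBundle_succ_of_eq π hP hi]
      intro g' hg'
      rcases Finset.mem_insert.1 hg' with rfl | hg'
      · exact (best_position_le _ _ _ hg).trans hx
      · exact ih g' hg'
    · rw [rrBundle_succ_of_ne π hi]
      exact ih

/-- At time `t` agent `i` ranks all items of agent `j` above all unallocated items. -/
def EnvyAt (π : Fin n → ItemOrder m) (i j : Fin n) (t : ℕ) : Prop :=
  ∀ g ∈ rrBundle π t j, ∀ h ∈ rrPool π t, (π i).symm g < (π i).symm h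

end RoundRobin

/-! ### From a failure of SD-fairness to an envious turn -/

section StochasticDominance

variable {n m : ℕ}

/-- Dominance tested by counting elements in prefixes: if the `k`-th element of `P` came after that
of `Q`, the prefix ending at the latter would contain too few elements of `P`. -/
theorem positionsGe_of_card_le {P Q : Finset (Fin m)}
    (h : ∀ x, (Q.filter (· ≤ x)).card ≤ (P.filter (· ≤ x)).card) : PositionsGe P Q := by
  have hc : Q.card ≤ P.card := by
    rcases Q.eq_empty_or_nonempty with rfl | hQ
    · simp
    · calc Q.card = (Q.filter (· ≤ Q.max' hQ)).card := by
            rw [Finset.filter_true_of_mem fun y hy => Q.le_max' y hy]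
        _ ≤ _ := h _
        _ ≤ P.card := Finset.card_filter_le _ _
  refine ⟨hc, fun k => ?_⟩
  by_contra hlt
  rw [not_le] at hlt
  set x := Q.orderEmbOfFin rfl k with hx
  have h1 : k.1 + 1 ≤ (Q.filter (· ≤ x)).card := by
    have : (Finset.Iic k).map (Q.orderEmbOfFin rfl).toEmbedding ⊆ Q.filter (· ≤ x) := by
      intro y hy
      obtain ⟨l, hl, rfl⟩ := Finset.mem_map.1 hy
      refine Finset.mem_filter.2 ⟨Finset.orderEmbOfFin_mem _ _ _, ?_⟩
      exact (Q.orderEmbOfFin rfl).monotone (Finset.mem_Iic.1 hl)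
    have := Finset.card_le_card this
    rwa [Finset.card_map, Fin.card_Iic] at this
  have h2 : (P.filter (· ≤ x)).card ≤ k.1 := by
    have : P.filter (· ≤ x) ⊆
        (Finset.Iio (Fin.castLE hc k)).map (P.orderEmbOfFin rfl).toEmbedding := by
      intro y hy
      obtain ⟨hy, hyx⟩ := Finset.mem_filter.1 hy
      have : y ∈ Set.range (P.orderEmbOfFin rfl) := by
        rw [Finset.range_orderEmbOfFin]; exact hy
      obtain ⟨l, rfl⟩ := this
      refine Finset.mem_map.2 ⟨l, Finset.mem_Iio.2 ?_, rfl⟩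
      exact (P.orderEmbOfFin rfl).lt_iff_lt.1 (lt_of_le_of_lt hyx hlt)
    have := Finset.card_le_card this
    rwa [Finset.card_map, Fin.card_Iio] at this
  have := h x
  omega

theorem sdGe_of_card_le {π : ItemOrder m} {A B : Finset (Fin m)}
    (h : ∀ x, (B.filter (fun g => π.symm g ≤ x)).card ≤
      (A.filter (fun g => π.symm g ≤ x)).card) : SDGe π A B := by
  refine positionsGe_of_card_le fun x => ?_
  have key : ∀ D : Finset (Fin m),
      ((positions π D).filter (· ≤ x)).card = (D.filter (fun g => π.symm g ≤ x)).card := by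
    intro D
    rw [positions, Finset.filter_map, Finset.card_map]
    rfl
  rw [key, key]
  exact h x

theorem sdGe_rename_iff (ρ : Equiv.Perm (Fin m)) (σ : ItemOrder m) (A B : Finset (Fin m)) :
    SDGe (renameOrdering ρ σ) A B ↔
      SDGe σ (A.map ρ.symm.toEmbedding) (B.map ρ.symm.toEmbedding) := by
  have key : ∀ D : Finset (Fin m),
      positions (renameOrdering ρ σ) D = positions σ (D.map ρ.symm.toEmbedding) := by
    intro D
    simp only [positions, Finset.map_map]
    rfl
  simp only [SDGe, key]

theorem rename_le_rename {ρ : Equiv.Perm (Fin m)} {σ : ItemOrder m} {v : BundleValuation m}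
    (hv : OrderConsistentWith σ v) {A B : Finset (Fin m)} (h : SDGe (renameOrdering ρ σ) A B) :
    rename ρ v B ≤ rename ρ v A :=
  hv _ _ ((sdGe_rename_iff ρ σ A B).1 h)

theorem Allocation.IsSDEF.isEF {A : Allocation n m} {ρ : Fin n → Equiv.Perm (Fin m)}
    {σ : Fin n → ItemOrder m} {v : Fin n → BundleValuation m}
    (hv : ∀ i, OrderConsistentWith (σ i) (v i))
    (h : A.IsSDEF (fun i => renameOrdering (ρ i) (σ i))) : A.IsEF (fun i => rename (ρ i) (v i)) :=
  fun i j => rename_le_rename (hv i) (h i j)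

theorem Allocation.IsSDEFX.isEFX {A : Allocation n m} {ρ : Fin n → Equiv.Perm (Fin m)}
    {σ : Fin n → ItemOrder m} {v : Fin n → BundleValuation m}
    (hv : ∀ i, OrderConsistentWith (σ i) (v i))
    (h : A.IsSDEFX (fun i => renameOrdering (ρ i) (σ i))) :
    A.IsEFX (fun i => rename (ρ i) (v i)) :=
  fun i j g hg => rename_le_rename (hv i) (h i j g hg)

variable [NeZero n] (π : Fin n → ItemOrder m)

/-- If more than `c` items of `B ⊆ A_j` but only `c` items of `A_i` are among the first positions of
agent `i`, then `j` precedes `i` in the picking order, and `i` is envious at her pick number `c`. -/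
theorem envyAt_of_card_lt {i j : Fin n} {B : Finset (Fin m)} {x : Fin m} {c : ℕ}
    (hB : B ⊆ rrBundle π m j)
    (hc : ((rrBundle π m i).filter (fun g => (π i).symm g ≤ x)).card = c)
    (hlt : c < (B.filter (fun g => (π i).symm g ≤ x)).card) (hT : c * n + i < m) :
    j < i ∧ rrBundle π (c * n + i) j ⊆ B ∧ EnvyAt π i j (c * n + i) := by
  -- If some item of the prefix were still in the pool, then `i`'s first `c + 1` picks would all lie
  -- in the prefix, which contains only `c` of her items.
  have hpool : ∀ g ∈ rrPool π (c * n + i), x < (π i).symm g := by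
    by_contra! hcon
    have h1 := position_le_of_mem_rrBundle π i x hcon
    have h2 : rrBundle π (c * n + i + 1) i ⊆
        (rrBundle π m i).filter (fun g => (π i).symm g ≤ x) := fun g hg =>
      Finset.mem_filter.2 ⟨rrBundle_mono π i (by omega : c * n + i + 1 ≤ m) hg, h1 g hg⟩
    have h3 := Finset.card_le_card h2
    have h4 : (rrBundle π (c * n + i + 1) i).card = c + 1 := by
      have hi := i.2
      rw [rrBundle_card π (by omega)]
      have : c * n + i + 1 + (n - 1 - i) = (c + 1) * n := by rw [add_mul]; omega
      rw [this, Nat.mul_div_cancel _ (by omega)]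
    omega
  have hsub : B.filter (fun g => (π i).symm g ≤ x) ⊆ rrBundle π (c * n + i) j := by
    intro g hg
    obtain ⟨hgB, hgx⟩ := Finset.mem_filter.1 hg
    rcases Finset.mem_union.1 (rrBundle_subset_union π hT.le j (hB hgB)) with h | h
    · exact h
    · exact absurd hgx (not_le.2 (hpool g h))
  have hle := Finset.card_le_card hsub
  have hji : j < i := by
    by_contra hcon
    rw [rrBundle_card_turn_of_le π (not_lt.1 hcon) hT.le] at hle
    omega
  have heq : B.filter (fun g => (π i).symm g ≤ x) = rrBundle π (c * n + i) j := by
    refine Finset.eq_of_subset_of_card_le hsub ?_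
    rw [rrBundle_card_turn_of_lt π hji hT.le]
    omega
  refine ⟨hji, heq ▸ Finset.filter_subset _ _, fun g hg h hh => ?_⟩
  rw [← heq] at hg
  exact (Finset.mem_filter.1 hg).2.trans_lt (hpool h hh)

theorem exists_envyAt_of_not_isSDEF (hn : n ∣ m) (h : ¬ (roundRobin π).IsSDEF π) :
    ∃ c : ℕ, ∃ i j : Fin n, j < i ∧ c * n + i < m ∧ EnvyAt π i j (c * n + i) := by
  simp only [Allocation.IsSDEF, not_forall] at h
  obtain ⟨i, j, hij⟩ := h
  have hx : ∃ x, ((rrBundle π m i).filter (fun g => (π i).symm g ≤ x)).card <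
      ((rrBundle π m j).filter (fun g => (π i).symm g ≤ x)).card := by
    by_contra! hcon
    exact hij (sdGe_of_card_le hcon)
  obtain ⟨x, hx⟩ := hx
  -- Divisibility gives `j` exactly `m / n` items, so `c < m / n` and pick number `c` of agent `i`
  -- does take place.
  have hT : ((rrBundle π m i).filter (fun g => (π i).symm g ≤ x)).card * n + i < m := by
    have h1 := hx.trans_le (Finset.card_filter_le _ _)
    have hj := j.2
    rw [rrBundle_card π le_rfl] at h1
    obtain ⟨q, rfl⟩ := hn
    have h2 : (n * q + (n - 1 - j)) / n = q := by
      rw [add_comm, Nat.add_mul_div_left _ _ (by omega), Nat.div_eq_of_lt (by omega), zero_add]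
    rw [h2] at h1
    have hi := i.2
    nlinarith
  obtain ⟨h1, -, h2⟩ := envyAt_of_card_lt π subset_rfl rfl hx hT
  exact ⟨_, i, j, h1, hT, h2⟩

theorem exists_envyAt_of_not_isSDEFX (h : ¬ (roundRobin π).IsSDEFX π) :
    ∃ c : ℕ, ∃ i j : Fin n, j < i ∧ c * n + i + 1 < m ∧ EnvyAt π i j (c * n + i) := by
  simp only [Allocation.IsSDEFX, not_forall] at h
  obtain ⟨i, j, g, hg, hij⟩ := h
  change g ∈ rrBundle π m j at hg
  have hx : ∃ x, ((rrBundle π m i).filter (fun g => (π i).symm g ≤ x)).card <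
      (((rrBundle π m j).erase g).filter (fun g => (π i).symm g ≤ x)).card := by
    by_contra! hcon
    exact hij (sdGe_of_card_le hcon)
  obtain ⟨x, hx⟩ := hx
  have hlt := hx.trans_le (Finset.card_filter_le _ _)
  rw [Finset.card_erase_of_mem hg] at hlt
  generalize hc : ((rrBundle π m i).filter (fun g => (π i).symm g ≤ x)).card = c at hx hlt
  have hi := i.2
  have hj := j.2
  have hT : c * n + i < m := by
    by_contra hcon
    rw [rrBundle_card π le_rfl] at hlt
    have h2 : (m + (n - 1 - j)) / n ≤ c + 1 := by
      have h3 : m + (n - 1 - j) < (c + 2) * n := by rw [add_mul]; omega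
      have := (Nat.div_lt_iff_lt_mul (by omega)).2 h3
      omega
    omega
  obtain ⟨h1, h2, h3⟩ := envyAt_of_card_lt π (Finset.erase_subset _ _) hc hx hT
  refine ⟨c, i, j, h1, ?_, h3⟩
  -- If this were the last pick of the run, `j` would already hold the removed item `g`,
  -- contradicting that her bundle at this time is contained in `A_j \ {g}`.
  by_contra hcon
  have hm : m = c * n + i + 1 := by omega
  have hgp : g ∉ rrBundle π (c * n + i) j := fun hg' => Finset.notMem_erase g _ (h2 hg')
  have hturn : Fin.ofNat n (c * n + i) ≠ j := by
    rw [Ne, ofNat_eq_iff_mod, Nat.mul_add_mod_self_right, Nat.mod_eq_of_lt hi]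
    exact fun e => (ne_of_gt h1) (Fin.ext e)
  apply hgp
  rw [← rrBundle_succ_of_ne π hturn, ← hm]
  exact hg

end StochasticDominance

/-! ### The supersolution of the envy recursion -/

section EnvyBound

open Finset in
/-- Upper bound for the conditional probability of `EnvyAt`, when `d` rounds remain until the turn
at which `R` items are left, and `Y` items of the envied bundle have not been inspected. -/
noncomputable def envyBound (n R d Y : ℕ) : ℝ :=
  (∏ e ∈ range d, ((R + (e + 1) * n : ℝ) / ((e + 1) * n))) / ((Y + d + R).choose R : ℝ)

theorem envyBound_nonneg (n R d Y : ℕ) : 0 ≤ envyBound n R d Y := by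
  unfold envyBound; positivity

theorem envyBound_zero_zero (n R : ℕ) : envyBound n R 0 0 = 1 := by
  simp [envyBound]

theorem choose_add_succ_mul (Z R : ℕ) :
    ((Z + 1 + R).choose R : ℝ) * (Z + 1) = ((Z + R).choose R : ℝ) * (Z + 1 + R) := by
  have h := Nat.choose_mul_succ_eq (Z + R) R
  have e : Z + R + 1 - R = Z + 1 := by omega
  rw [e] at h
  have e2 : Z + 1 + R = Z + R + 1 := by omega
  rw [e2]
  have : ((Z + R).choose R : ℝ) * ((Z + R : ℕ) + 1) = ((Z + R + 1).choose R : ℝ) * (Z + 1) := by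
    exact_mod_cast h
  push_cast at this
  linarith

/-- The term of the recursion in which an item of `j` is revealed. Together with
`mul_envyBound_succ`, which handles a revealed pool item, the right-hand sides add up to `(R + d n +
Y)` times the bound at `(d, Y)`, for `d` at least 1. -/
theorem mul_envyBound_pred_le (n R d Y : ℕ) :
    (Y : ℝ) * envyBound n R d (Y - 1) ≤ (Y + R) * envyBound n R d Y := by
  rcases Y with _ | Y
  · have := envyBound_nonneg n R d 0
    simp only [Nat.cast_zero, zero_mul, zero_add]
    positivity
  · unfold envyBound
    rw [Nat.add_sub_cancel]
    have hA : (0 : ℝ) ≤ ∏ e ∈ Finset.range d, ((R + (e + 1) * n : ℝ) / ((e + 1) * n)) := by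
      positivity
    have h := choose_add_succ_mul (Y + d) R
    have h1 : (0 : ℝ) < ((Y + d + R).choose R : ℝ) := by
      exact_mod_cast Nat.choose_pos (by omega)
    have h2 : (0 : ℝ) < ((Y + d + 1 + R).choose R : ℝ) := by
      exact_mod_cast Nat.choose_pos (by omega)
    have e : Y + 1 + d + R = Y + d + 1 + R := by omega
    rw [e, mul_div_assoc', mul_div_assoc', div_le_div_iff₀ h1 h2]
    push_cast at h ⊢
    set A := ∏ e ∈ Finset.range d, ((R + (e + 1) * n : ℝ) / ((e + 1) * n))
    set c := ((Y + d + R).choose R : ℝ)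
    set c' := ((Y + d + 1 + R).choose R : ℝ)
    have h3 : (Y + 1 : ℝ) * c' ≤ (Y + 1 + R) * c := by
      have hpos : (0 : ℝ) < Y + d + 1 := by positivity
      refine le_of_mul_le_mul_right ?_ hpos
      calc (Y + 1 : ℝ) * c' * (Y + d + 1) = (Y + 1) * (c * (Y + d + 1 + R)) := by rw [← h]; ring
        _ ≤ (Y + 1 + R) * c * (Y + d + 1) := by
          have : 0 ≤ c * (R * d : ℝ) := by positivity
          nlinarith
    nlinarith

theorem mul_envyBound_succ {n : ℕ} (hn : 0 < n) (R d Y : ℕ) :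
    (R + (d + 1) * n : ℝ) * envyBound n R d (Y + 1) = (d + 1) * n * envyBound n R (d + 1) Y := by
  unfold envyBound
  have hn' : (0 : ℝ) < n := by exact_mod_cast hn
  rw [Finset.prod_range_succ]
  have e : Y + 1 + d + R = Y + (d + 1) + R := by omega
  rw [e]
  field_simp

end EnvyBound

/-! ### Permutations with a prescribed initial segment -/

section Cylinders

variable {n m : ℕ}

open Classical in
/-- The permutations that agree with `τ` on the first `s` positions. -/
noncomputable def cyl (τ : Equiv.Perm (Fin m)) (s : ℕ) : Finset (Equiv.Perm (Fin m)) :=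
  Finset.univ.filter fun τ' => ∀ u : Fin m, u.1 < s → τ' u = τ u

theorem mem_cyl {τ τ' : Equiv.Perm (Fin m)} {s : ℕ} :
    τ' ∈ cyl τ s ↔ ∀ u : Fin m, u.1 < s → τ' u = τ u := by
  simp [cyl]

theorem self_mem_cyl (τ : Equiv.Perm (Fin m)) (s : ℕ) : τ ∈ cyl τ s := mem_cyl.2 fun _ _ => rfl

theorem le_symm_iff_of_mem_cyl {τ τ' : Equiv.Perm (Fin m)} {s : ℕ} (h : τ' ∈ cyl τ s)
    (g : Fin m) : s ≤ (τ'.symm g).1 ↔ s ≤ (τ.symm g).1 := by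
  rw [mem_cyl] at h
  rw [← not_iff_not, not_le, not_le]
  constructor <;> intro hlt
  · have := h _ hlt
    rw [Equiv.apply_symm_apply] at this
    rwa [this, Equiv.symm_apply_apply]
  · have := h _ hlt
    rw [Equiv.apply_symm_apply] at this
    rwa [← this, Equiv.symm_apply_apply]

/-- `τ * Equiv.swap s u` serves as a representative: it keeps the revealed positions and moves the
item `τ u` into position `s`. -/
theorem mem_cyl_mul_swap_iff {τ τ' : Equiv.Perm (Fin m)} {s u : Fin m} (hu : s ≤ u) :
    τ' ∈ cyl (τ * Equiv.swap s u) (s + 1) ↔ τ' ∈ cyl τ s ∧ τ' s = τ u := by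
  simp only [mem_cyl]
  have hlt : ∀ v : Fin m, v.1 < s.1 → (τ * Equiv.swap s u) v = τ v := by
    intro v hv
    rw [Equiv.Perm.mul_apply, Equiv.swap_apply_of_ne_of_ne]
    · exact ne_of_lt hv
    · exact ne_of_lt (lt_of_lt_of_le hv hu)
  constructor
  · intro h
    refine ⟨fun v hv => ?_, ?_⟩
    · rw [h v (by omega), hlt v hv]
    · rw [h s (by omega), Equiv.Perm.mul_apply, Equiv.swap_apply_left]
  · rintro ⟨h1, h2⟩ v hv
    rcases Nat.lt_succ_iff_lt_or_eq.1 hv with hv | hv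
    · rw [h1 v hv, hlt v hv]
    · obtain rfl : v = s := Fin.ext hv
      rw [h2, Equiv.Perm.mul_apply, Equiv.swap_apply_left]

open Classical in
theorem card_filter_cyl_eq_sum (τ : Equiv.Perm (Fin m)) (s : Fin m)
    (E : Equiv.Perm (Fin m) → Prop) :
    ((cyl τ s).filter E).card =
      ∑ u ∈ Finset.Ici s, ((cyl (τ * Equiv.swap s u) (s + 1)).filter E).card := by
  have hmaps : Set.MapsTo (fun τ' : Equiv.Perm (Fin m) => τ.symm (τ' s))
      ((cyl τ s).filter E) (Finset.Ici s : Finset (Fin m)) := by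
    intro τ' hτ'
    have h := (Finset.mem_filter.1 (Finset.mem_coe.1 hτ')).1
    refine Finset.mem_coe.2 (Finset.mem_Ici.2 ?_)
    have := (le_symm_iff_of_mem_cyl h (τ' s)).1 (by rw [Equiv.symm_apply_apply])
    exact this
  rw [Finset.card_eq_sum_card_fiberwise hmaps]
  refine Finset.sum_congr rfl fun u hu => ?_
  congr 1
  ext τ'
  simp only [Finset.mem_filter, mem_cyl_mul_swap_iff (Finset.mem_Ici.1 hu), Equiv.symm_apply_eq]
  tauto

theorem card_cyl (τ : Equiv.Perm (Fin m)) {s : ℕ} (hs : s ≤ m) :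
    (cyl τ s).card = (m - s).factorial := by
  classical
  obtain ⟨q, hq⟩ : ∃ q, s + q = m := ⟨m - s, by omega⟩
  induction q generalizing s τ with
  | zero =>
    have : cyl τ s = {τ} := by
      ext τ'
      rw [mem_cyl, Finset.mem_singleton]
      refine ⟨fun h => Equiv.ext fun u => h u (by omega), fun h u _ => by rw [h]⟩
    rw [this, show m - s = 0 by omega]
    rfl
  | succ q ih =>
    have h := card_filter_cyl_eq_sum τ ⟨s, by omega⟩ (fun _ => True)
    simp only [Finset.filter_true] at h
    rw [h, Finset.sum_congr rfl fun u _ => ih _ (by omega) (by omega), Finset.sum_const,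
      Fin.card_Ici, smul_eq_mul, show m - s = m - (s + 1) + 1 by omega, Nat.factorial_succ]

end Cylinders

/-! ### Dependence of the Round-Robin state on one agent's ordering -/

section Scan

variable {n m : ℕ} [NeZero n]

theorem rrState_succ_congr {π π' : Fin n → ItemOrder m} {t : ℕ}
    (h : rrState π t = rrState π' t) (hπ : π (Fin.ofNat n t) = π' (Fin.ofNat n t)) :
    rrState π (t + 1) = rrState π' (t + 1) := by
  let step (i : Fin n) (τ : ItemOrder m) (s : (Fin n → Finset (Fin m)) × Finset (Fin m)) :=
    if hP : s.2.Nonempty then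
      (Function.update s.1 i (insert (best τ s.2 hP) (s.1 i)), s.2.erase (best τ s.2 hP))
    else s
  change step _ (π (Fin.ofNat n t)) (rrState π t) = step _ (π' (Fin.ofNat n t)) (rrState π' t)
  rw [h, hπ]

theorem rrState_congr_of_no_turn {π π' : Fin n → ItemOrder m} {i : Fin n} {t a : ℕ}
    (h : rrState π t = rrState π' t) (hπ : ∀ l, l ≠ i → π l = π' l)
    (hturn : ∀ b < a, Fin.ofNat n (t + b) ≠ i) :
    rrState π (t + a) = rrState π' (t + a) := by
  induction a with
  | zero => exact h
  | succ a ih =>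
    exact rrState_succ_congr (ih fun b hb => hturn b (by omega)) (hπ _ (hturn a (by omega)))

theorem rrState_succ_congr_of_best {π π' : Fin n → ItemOrder m} {t : ℕ}
    (h : rrState π t = rrState π' t) {x : Fin m} (hP : (rrPool π t).Nonempty)
    (hP' : (rrPool π' t).Nonempty)
    (hx : best (π (Fin.ofNat n t)) (rrPool π t) hP = x)
    (hx' : best (π' (Fin.ofNat n t)) (rrPool π' t) hP' = x) :
    rrState π (t + 1) = rrState π' (t + 1) := by
  rw [rrState_succ_of_nonempty π hP, rrState_succ_of_nonempty π' hP', hx, hx']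
  simp only [rrBundle, rrPool, h]

theorem ofNat_turn (r : ℕ) (i : Fin n) : Fin.ofNat n (r * n + i) = i := by
  rw [ofNat_eq_iff_mod, Nat.mul_add_mod_self_right, Nat.mod_eq_of_lt i.2]

theorem ofNat_turn_add_ne (r : ℕ) (i : Fin n) {b : ℕ} (h0 : 0 < b) (hb : b < n) :
    Fin.ofNat n (r * n + i + b) ≠ i := by
  rw [Ne, ofNat_eq_iff_mod, add_assoc, Nat.mul_add_mod_self_right]
  intro h
  have hi := i.2
  rcases lt_or_ge (i.1 + b) n with h1 | h1
  · rw [Nat.mod_eq_of_lt h1] at h; omega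
  · rw [Nat.mod_eq_sub_mod h1, Nat.mod_eq_of_lt (by omega)] at h; omega

theorem ofNat_lt_ne (i : Fin n) {b : ℕ} (hb : b < i.1) : Fin.ofNat n (0 + b) ≠ i := by
  have hi := i.2
  rw [Ne, ofNat_eq_iff_mod, zero_add, Nat.mod_eq_of_lt (by omega)]
  omega

/-- If agent `i` takes `x` at her turn, then one round later agent `j ≠ i` has exactly one more
item, which was in the pool and is not `x`. -/
theorem exists_rrBundle_round_eq_insert (π : Fin n → ItemOrder m) {i j : Fin n} (hij : j < i)
    {r : ℕ} (hT : (r + 1) * n + i ≤ m) (hP : (rrPool π (r * n + i)).Nonempty) :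
    ∃ y ∈ rrPool π (r * n + i), y ≠ best (π i) (rrPool π (r * n + i)) hP ∧
      rrBundle π ((r + 1) * n + i) j = insert y (rrBundle π (r * n + i) j) := by
  have hi := i.2
  have e : (r + 1) * n + i = r * n + i + n := by ring
  have hle : r * n + i ≤ (r + 1) * n + i := by omega
  have hsub : rrBundle π (r * n + i) j ⊆ rrBundle π ((r + 1) * n + i) j := rrBundle_mono π j hle
  have hc1 := rrBundle_card_turn_of_lt π hij hT
  have hc2 := rrBundle_card_turn_of_lt π hij (hle.trans hT)
  have hc : (rrBundle π ((r + 1) * n + i) j \ rrBundle π (r * n + i) j).card = 1 := by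
    rw [Finset.card_sdiff_of_subset hsub]; omega
  obtain ⟨y, hy⟩ := Finset.card_eq_one.1 hc
  have hy' : y ∈ rrBundle π ((r + 1) * n + i) j \ rrBundle π (r * n + i) j := by simp [hy]
  obtain ⟨hy1, hy2⟩ := Finset.mem_sdiff.1 hy'
  refine ⟨y, ?_, ?_, ?_⟩
  · exact (Finset.mem_union.1 (rrBundle_subset_union π hle j hy1)).resolve_left hy2
  · rintro rfl
    have h1 : best (π i) (rrPool π (r * n + i)) hP ∈ rrBundle π ((r + 1) * n + i) i := by
      have h2 := rrBundle_succ_of_eq π hP (ofNat_turn r i)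
      refine rrBundle_mono π i (by omega : r * n + i + 1 ≤ (r + 1) * n + i) ?_
      simp only [h2, Finset.mem_insert_self]
    exact Finset.disjoint_left.1 ((rrState_invariant π _).1 j i hij.ne) hy1 h1
  · rw [Finset.insert_eq, ← hy, Finset.sdiff_union_of_subset hsub]

end Scan

/-! ### Probability of envy at a given turn, by revealing one ordering -/

section EnvyProbability

variable {n m : ℕ}

open Finset in
-- One step of the recursion: `P` stands for pool items and `Q` for unrevealed items of `j`. All
-- other items leave the bound at `c`, so only the average over `P` and `Q` has to be at most `c`.
theorem sum_le_of_classification {α : Type*} [DecidableEq α] (U P Q : Finset α) (hP : P ⊆ U)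
    (hQ : Q ⊆ U) (hPQ : Disjoint P Q) (f : α → ℝ) {a b c : ℝ} (ha : ∀ u ∈ P, f u ≤ a)
    (hb : ∀ u ∈ Q, f u ≤ b) (hc : ∀ u ∈ U, u ∉ P → u ∉ Q → f u ≤ c)
    (h : #P * a + #Q * b ≤ (#P + #Q) * c) : ∑ u ∈ U, f u ≤ #U * c := by
  have h1 : ∑ u ∈ U, f u ≤ ∑ u ∈ U, (c + (if u ∈ P then a - c else 0) +
      (if u ∈ Q then b - c else 0)) := by
    refine sum_le_sum fun u hu => ?_
    by_cases hp : u ∈ P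
    · have hq : u ∉ Q := disjoint_left.1 hPQ hp
      simpa [hp, hq] using ha u hp
    · by_cases hq : u ∈ Q
      · simpa [hp, hq] using hb u hq
      · simpa [hp, hq] using hc u hu hp hq
  rw [sum_add_distrib, sum_add_distrib, sum_const, ← sum_filter, ← sum_filter,
    filter_mem_eq_inter, filter_mem_eq_inter, inter_eq_right.2 hP, inter_eq_right.2 hQ,
    sum_const, sum_const] at h1
  simp only [nsmul_eq_mul] at h1
  linarith

open Classical in
/-- Averaging over the ordering of agent `i` alone. -/
theorem renamingProb_le_of_update (i : Fin n) (E : (Fin n → Equiv.Perm (Fin m)) → Prop) {b : ℝ}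
    (h : ∀ π : Fin n → Equiv.Perm (Fin m),
      ((Finset.univ.filter fun τ => E (Function.update π i τ)).card : ℝ) ≤ m.factorial * b) :
    renamingProb n m E ≤ b := by
  have hfac : (0 : ℝ) < m.factorial := by exact_mod_cast Nat.factorial_pos m
  have hcard : (0 : ℝ) < Fintype.card (Fin n → Equiv.Perm (Fin m)) := by
    exact_mod_cast Fintype.card_pos
  let f : (Fin n → Equiv.Perm (Fin m)) → ℝ := fun π => if E π then 1 else 0
  -- Multiplying the `i`-th coordinate by a fixed permutation is a bijection of the tuples.
  -- Averaging over that permutation resamples ordering `i` alone.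
  have hshift : ∀ τ : Equiv.Perm (Fin m),
      ∑ π : Fin n → Equiv.Perm (Fin m), f (Function.update π i (π i * τ)) = ∑ π, f π := by
    intro τ
    have h1 : ∀ π : Fin n → Equiv.Perm (Fin m),
        Function.update π i (π i * τ) = π * Pi.mulSingle i τ := by
      intro π
      ext l x
      by_cases hl : l = i
      · subst hl; simp
      · simp [hl]
    simp only [h1]
    exact Equiv.sum_comp (Equiv.mulRight (Pi.mulSingle i τ : Fin n → Equiv.Perm (Fin m))) f
  have hswap : (m.factorial : ℝ) * ∑ π, f π ≤
      Fintype.card (Fin n → Equiv.Perm (Fin m)) * (m.factorial * b) := by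
    calc (m.factorial : ℝ) * ∑ π, f π
        = ∑ τ : Equiv.Perm (Fin m), ∑ π : Fin n → Equiv.Perm (Fin m),
            f (Function.update π i (π i * τ)) := by
          rw [Finset.sum_congr rfl fun τ _ => hshift τ, Finset.sum_const, Finset.card_univ,
            Fintype.card_perm, Fintype.card_fin, nsmul_eq_mul]
      _ = ∑ π : Fin n → Equiv.Perm (Fin m), ∑ τ : Equiv.Perm (Fin m),
            f (Function.update π i τ) := by
          rw [Finset.sum_comm]
          refine Finset.sum_congr rfl fun π _ => ?_
          exact Equiv.sum_comp (Equiv.mulLeft (π i)) fun τ => f (Function.update π i τ)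
      _ ≤ ∑ π : Fin n → Equiv.Perm (Fin m), (m.factorial * b) := by
          refine Finset.sum_le_sum fun π _ => ?_
          have := h π
          simp only [f]
          rw [Finset.sum_boole]
          convert this
      _ = _ := by rw [Finset.sum_const, Finset.card_univ, nsmul_eq_mul]
  have hf : ∑ π, f π = ((Finset.univ.filter E).card : ℝ) := by
    simp only [f]; rw [Finset.sum_boole]
  rw [hf] at hswap
  unfold renamingProb
  rw [div_le_iff₀ hcard]
  have : (m.factorial : ℝ) * ((Finset.univ.filter E).card : ℝ) ≤
      m.factorial * (b * Fintype.card (Fin n → Equiv.Perm (Fin m))) := by linarith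
  have := le_of_mul_le_mul_left this hfac
  convert this

variable [NeZero n]

/-- The items of agent `j` after `t` picks that are not in the first `s` positions of `τ`. -/
def uninspected (π : Fin n → ItemOrder m) (j : Fin n) (t : ℕ) (τ : ItemOrder m) (s : ℕ) :
    Finset (Fin m) :=
  (rrBundle π t j).filter fun g => s ≤ (τ.symm g).1

open Classical in
-- Induction on the number `q` of unrevealed positions; `q !` is the size of the cylinder, so the
-- bound is a conditional probability. The invariants say that the revealed positions determine the
-- state at turn `r` and contain no item of its pool.
theorem card_filter_cyl_envyAt_le (π : Fin n → ItemOrder m) {i j : Fin n} (hij : j < i)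
    {k : ℕ} (hT : k * n + i < m) (q : ℕ) : ∀ (s r d : ℕ) (τ : ItemOrder m), s + q = m →
    r + d = k →
    (∀ τ' ∈ cyl τ s, rrState (Function.update π i τ') (r * n + i) =
      rrState (Function.update π i τ) (r * n + i)) →
    (∀ g ∈ rrPool (Function.update π i τ) (r * n + i), s ≤ (τ.symm g).1) →
    (((cyl τ s).filter fun τ' => EnvyAt (Function.update π i τ') i j (k * n + i)).card : ℝ) ≤
      q.factorial * envyBound n (m - (k * n + i)) d
        (uninspected (Function.update π i τ) j (r * n + i) τ s).card := by
  have hn : 0 < n := Nat.pos_of_ne_zero (NeZero.ne n)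
  induction q with
  | zero =>
    intro s r d τ hs hrd _ hpool
    have ht : r * n + i < m := lt_of_le_of_lt (by gcongr; omega) hT
    obtain ⟨g, hg⟩ := rrPool_nonempty (Function.update π i τ) ht
    have := hpool g hg
    omega
  | succ q ih =>
    intro s r d τ hs hrd hst hpool
    have hsm : s < m := by omega
    have ht : r * n + i < m := lt_of_le_of_lt (by gcongr; omega) hT
    set E := fun τ' => EnvyAt (Function.update π i τ') i j (k * n + i)
    set R := m - (k * n + i) with hR
    set P := rrPool (Function.update π i τ) (r * n + i) with hPdef
    set A := uninspected (Function.update π i τ) j (r * n + i) τ s with hAdef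
    have hPA : Disjoint P A := by
      refine Finset.disjoint_of_subset_right (Finset.filter_subset _ _) ?_
      exact (rrBundle_disjoint_rrPool _ _ _).symm
    have hPcard : P.card = R + d * n := by
      rw [hPdef, rrPool_card, hR, ← hrd, add_mul]
      have : k * n = r * n + d * n := by rw [← hrd, add_mul]
      omega
    have hcyl : ∀ u : Fin m, s ≤ u.1 → ∀ τ' ∈ cyl (τ * Equiv.swap ⟨s, hsm⟩ u) (s + 1),
        τ' ∈ cyl τ s ∧ τ' ⟨s, hsm⟩ = τ u := fun u hu τ' h =>
      (mem_cyl_mul_swap_iff (s := ⟨s, hsm⟩) (u := u) hu).1 h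
    have hsplit := card_filter_cyl_eq_sum τ ⟨s, hsm⟩ E
    simp only at hsplit
    rw [hsplit]
    push_cast
    -- the position of an item after moving `τ u` to position `s`
    have hpos : ∀ u : Fin m, s ≤ u.1 → ∀ τ' ∈ cyl (τ * Equiv.swap ⟨s, hsm⟩ u) (s + 1),
        ∀ g, s + 1 ≤ (τ'.symm g).1 ↔ s ≤ (τ.symm g).1 ∧ g ≠ τ u := by
      intro u hu τ' h g
      obtain ⟨h1, h2⟩ := hcyl u hu τ' h
      rw [← le_symm_iff_of_mem_cyl h1, ← h2]
      constructor
      · intro h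
        refine ⟨by omega, ?_⟩
        rintro rfl
        rw [Equiv.symm_apply_apply] at h
        simp at h
      · rintro ⟨h3, h4⟩
        refine lt_of_le_of_ne h3 fun h5 => h4 ?_
        rw [← Equiv.symm_apply_eq]
        exact Fin.ext h5.symm
    -- the state if the item in position `s` is not in the pool
    have hother : ∀ u : Fin m, s ≤ u.1 → τ u ∉ P →
        (((cyl (τ * Equiv.swap ⟨s, hsm⟩ u) (s + 1)).filter E).card : ℝ) ≤
          q.factorial * envyBound n R d (A.erase (τ u)).card := by
      intro u hu huP
      have hself := self_mem_cyl (τ * Equiv.swap ⟨s, hsm⟩ u) (s + 1)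
      have heq := hst _ (hcyl u hu _ hself).1
      have := ih (s + 1) r d (τ * Equiv.swap ⟨s, hsm⟩ u) (by omega) hrd
        (fun τ' h => by rw [hst _ (hcyl u hu _ h).1, heq])
        (fun g hg => by
          rw [hpos u hu _ hself]
          rw [rrPool, heq] at hg
          exact ⟨hpool g hg, fun e => huP (e ▸ hg)⟩)
      convert this using 4
      ext g
      rw [Finset.mem_erase, hAdef, uninspected, uninspected, Finset.mem_filter, Finset.mem_filter,
        hpos u hu _ hself, rrBundle, rrBundle, heq]
      tauto
    -- the state if the item in position `s` is in the pool
    have hpick : ∀ u : Fin m, s ≤ u.1 → τ u ∈ P →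
        ∀ τ' ∈ cyl (τ * Equiv.swap ⟨s, hsm⟩ u) (s + 1),
          ∀ hP' : (rrPool (Function.update π i τ') (r * n + i)).Nonempty,
          best τ' (rrPool (Function.update π i τ') (r * n + i)) hP' = τ u := by
      intro u hu huP τ' h hP'
      obtain ⟨h1, h2⟩ := hcyl u hu τ' h
      have hpeq : rrPool (Function.update π i τ') (r * n + i) = P := by
        rw [hPdef, rrPool, rrPool, hst τ' h1]
      refine best_eq_of_forall_le _ _ _ (hpeq ▸ huP) fun g hg => ?_
      rw [hpeq] at hg
      rw [← h2, Equiv.symm_apply_apply, Fin.le_def]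
      exact (le_symm_iff_of_mem_cyl h1 g).2 (hpool g hg)
    -- Here `a` bounds the conditional probability after a pool item is revealed, and the inequality
    -- is the supersolution property at `(d, A.card)`.
    have hkey : ∃ a : ℝ, (∀ u : Fin m, s ≤ u.1 → τ u ∈ P →
        (((cyl (τ * Equiv.swap ⟨s, hsm⟩ u) (s + 1)).filter E).card : ℝ) ≤ q.factorial * a) ∧
        (R + d * n : ℝ) * a + A.card * envyBound n R d (A.card - 1) ≤
          (R + d * n + A.card) * envyBound n R d A.card := by
      have hpred := mul_envyBound_pred_le n R d A.card
      rcases d with _ | d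
      · obtain rfl : r = k := by omega
        rcases A.eq_empty_or_nonempty with hA | hA
        · refine ⟨1, fun u hu _ => ?_, ?_⟩
          · rw [mul_one]
            have h1 := Finset.card_filter_le (cyl (τ * Equiv.swap ⟨s, hsm⟩ u) (s + 1)) E
            rw [card_cyl _ (by omega), show m - (s + 1) = q by omega] at h1
            exact_mod_cast h1
          · rw [hA, Finset.card_empty, envyBound_zero_zero]
            simp
        -- At the target turn, a pool item revealed before a remaining item of `j` excludes envy.
        · refine ⟨0, fun u hu huP => ?_, by push_cast; linarith⟩
          rw [mul_zero, Nat.cast_nonpos, Finset.card_eq_zero, Finset.filter_eq_empty_iff]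
          intro τ' h hE
          obtain ⟨h1, h2⟩ := hcyl u hu τ' h
          obtain ⟨g, hg⟩ := hA
          have hst' := hst τ' h1
          have hgb : g ∈ rrBundle (Function.update π i τ') (r * n + i) j := by
            rw [rrBundle, hst']
            exact (Finset.mem_filter.1 hg).1
          have hup : τ u ∈ rrPool (Function.update π i τ') (r * n + i) := by
            rw [rrPool, hst']; exact huP
          have hlt := hE g hgb (τ u) hup
          rw [Function.update_self, ← h2, Equiv.symm_apply_apply, Fin.lt_def] at hlt
          have := (le_symm_iff_of_mem_cyl h1 g).2 (Finset.mem_filter.1 hg).2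
          simp only at hlt
          omega
      -- The revealed pool item is picked by `i`; within the round `j` gains an item `y` of the old
      -- pool other than this one, and it is unrevealed because no pool item had been revealed
      -- before.
      · refine ⟨envyBound n R d (A.card + 1), fun u hu huP => ?_, ?_⟩
        · have hself := self_mem_cyl (τ * Equiv.swap ⟨s, hsm⟩ u) (s + 1)
          have hnext : ∀ τ' ∈ cyl (τ * Equiv.swap ⟨s, hsm⟩ u) (s + 1),
              rrState (Function.update π i τ') ((r + 1) * n + i) =
              rrState (Function.update π i (τ * Equiv.swap ⟨s, hsm⟩ u)) ((r + 1) * n + i) := by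
            intro τ' h
            have e : (r + 1) * n + i = r * n + i + 1 + (n - 1) := by rw [add_mul]; omega
            rw [e]
            refine rrState_congr_of_no_turn (i := i) ?_ ?_ ?_
            · refine rrState_succ_congr_of_best (x := τ u)
                ((hst _ (hcyl u hu _ h).1).trans (hst _ (hcyl u hu _ hself).1).symm)
                (rrPool_nonempty _ ht) (rrPool_nonempty _ ht) ?_ ?_
              · simp only [ofNat_turn, Function.update_self]
                exact hpick u hu huP τ' h _
              · simp only [ofNat_turn, Function.update_self]
                exact hpick u hu huP _ hself _
            · intro l hl
              rw [Function.update_of_ne hl, Function.update_of_ne hl]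
            · intro b hb
              rw [add_assoc _ 1 b]
              exact ofNat_turn_add_ne r i (by omega) (by omega)
          set τ₁ := τ * Equiv.swap ⟨s, hsm⟩ u
          have hst₁ := hst _ (hcyl u hu _ hself).1
          have hne : (rrPool (Function.update π i τ₁) (r * n + i)).Nonempty := rrPool_nonempty _ ht
          have hbest := hpick u hu huP _ hself hne
          have hT' : (r + 1) * n + i ≤ m := by
            refine le_trans ?_ hT.le
            gcongr
            omega
          have hpool₁ : ∀ g ∈ rrPool (Function.update π i τ₁) (r * n + i),
              g ≠ τ u → s + 1 ≤ (τ₁.symm g).1 := by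
            intro g hg hgu
            rw [hpos u hu _ hself]
            rw [rrPool, hst₁] at hg
            exact ⟨hpool g hg, hgu⟩
          have := ih (s + 1) (r + 1) d τ₁ (by omega) (by omega) hnext
            (fun g hg => by
              have e : r * n + i + 1 ≤ (r + 1) * n + i := by rw [add_mul]; omega
              have hg' := rrPool_antitone _ e hg
              simp only [rrPool, rrState_succ_of_nonempty _ hne, ofNat_turn,
                Function.update_self] at hg'
              obtain ⟨hg1, hg2⟩ := Finset.mem_erase.1 hg'
              refine hpool₁ g hg2 fun e => hg1 ?_
              rw [e]; exact hbest.symm)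
          convert this using 4
          obtain ⟨y, hy, hyb, hins⟩ :=
            exists_rrBundle_round_eq_insert (Function.update π i τ₁) hij hT' hne
          simp only [Function.update_self] at hyb
          rw [hbest] at hyb
          have hyA : y ∉ A := by
            intro hyA
            have h1 := (Finset.mem_filter.1 hyA).1
            rw [rrPool, hst₁] at hy
            exact Finset.disjoint_left.1 (rrBundle_disjoint_rrPool _ _ _) h1 hy
          rw [← Finset.card_insert_of_notMem hyA]
          congr 1
          ext g
          rw [uninspected, hins, Finset.mem_filter, Finset.mem_insert, Finset.mem_insert, hAdef,
            uninspected, Finset.mem_filter, hpos u hu _ hself, rrBundle, rrBundle, hst₁]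
          constructor
          · rintro (rfl | ⟨h1, h2⟩)
            · exact ⟨Or.inl rfl, (hpos u hu _ hself _).1 (hpool₁ _ hy hyb)⟩
            · refine ⟨Or.inr h1, h2, ?_⟩
              rintro rfl
              exact Finset.disjoint_left.1 (rrBundle_disjoint_rrPool _ _ _) h1 huP
          · rintro ⟨rfl | h1, h2, h3⟩
            · exact Or.inl rfl
            · exact Or.inr ⟨h1, h2⟩
        · have := mul_envyBound_succ hn R d A.card
          push_cast
          rw [this]
          nlinarith
    obtain ⟨a, ha, hle⟩ := hkey
    have hsum := sum_le_of_classification (Finset.Ici (⟨s, hsm⟩ : Fin m))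
      (P.map τ.symm.toEmbedding) (A.map τ.symm.toEmbedding)
      (fun u hu => by
        obtain ⟨g, hg, rfl⟩ := Finset.mem_map.1 hu
        exact Finset.mem_Ici.2 (hpool g hg))
      (fun u hu => by
        obtain ⟨g, hg, rfl⟩ := Finset.mem_map.1 hu
        exact Finset.mem_Ici.2 (Finset.mem_filter.1 hg).2)
      ((Finset.disjoint_map _).2 hPA)
      (fun u => (((cyl (τ * Equiv.swap ⟨s, hsm⟩ u) (s + 1)).filter E).card : ℝ))
      (a := q.factorial * a) (b := q.factorial * envyBound n R d (A.card - 1))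
      (c := q.factorial * envyBound n R d A.card)
      (fun u hu => by
        obtain ⟨g, hg, rfl⟩ := Finset.mem_map.1 hu
        exact ha _ (hpool g hg) (by simpa using hg))
      (fun u hu => by
        obtain ⟨g, hg, rfl⟩ := Finset.mem_map.1 hu
        have hg' : τ (τ.symm.toEmbedding g) = g := by simp
        have h1 := hother (τ.symm.toEmbedding g) (Finset.mem_filter.1 hg).2
          (by rw [hg']; exact Finset.disjoint_right.1 hPA hg)
        rw [hg', Finset.card_erase_of_mem hg] at h1
        exact h1)
      (fun u hu hu1 hu2 => by
        have huA : τ u ∉ A := fun h => hu2 (Finset.mem_map.2 ⟨τ u, h, by simp⟩)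
        have hu' : (⟨s, hsm⟩ : Fin m) ≤ u := Finset.mem_Ici.1 hu
        have h1 := hother u hu'
          (fun h => hu1 (Finset.mem_map.2 ⟨τ u, h, by simp⟩))
        rw [Finset.erase_eq_of_notMem huA] at h1
        exact h1)
      (by
        rw [Finset.card_map, Finset.card_map, hPcard]
        push_cast
        have hq : (0 : ℝ) ≤ q.factorial := by positivity
        nlinarith [mul_le_mul_of_nonneg_left hle hq])
    refine hsum.trans (le_of_eq ?_)
    rw [Fin.card_Ici]
    have : m - s = q + 1 := by omega
    simp only [this, Nat.factorial_succ]
    push_cast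
    ring

open Classical in
theorem card_filter_envyAt_update_le (π : Fin n → ItemOrder m) {i j : Fin n} (hij : j < i)
    {k : ℕ} (hT : k * n + i < m) :
    ((Finset.univ.filter fun τ => EnvyAt (Function.update π i τ) i j (k * n + i)).card : ℝ) ≤
      m.factorial * envyBound n (m - (k * n + i)) k 1 := by
  have hcyl : cyl (1 : ItemOrder m) 0 = Finset.univ := by
    ext τ; simp [mem_cyl]
  have h := card_filter_cyl_envyAt_le π hij hT m 0 0 k 1 (by omega) (by omega)
    (fun τ' _ => by
      rw [zero_mul]
      exact rrState_congr_of_no_turn (i := i) rfl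
        (fun l hl => by rw [Function.update_of_ne hl, Function.update_of_ne hl])
        (fun b hb => ofNat_lt_ne i hb))
    (fun g _ => Nat.zero_le _)
  rw [hcyl] at h
  -- Since `j < i`, agent `j` has picked exactly once before the first turn of `i`, hence `Y = 1` at
  -- the start.
  have hY : (uninspected (Function.update π i 1) j (0 * n + i) 1 0).card = 1 := by
    unfold uninspected
    rw [Finset.filter_true_of_mem fun g _ => Nat.zero_le _]
    refine rrBundle_card_turn_of_lt _ hij (le_trans ?_ hT.le)
    gcongr
    omega
  rwa [hY] at h

theorem renamingProb_envyAt_le {i j : Fin n} (hij : j < i) {k : ℕ} (hT : k * n + i < m) :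
    renamingProb n m (fun π => EnvyAt π i j (k * n + i)) ≤
      envyBound n (m - (k * n + i)) k 1 :=
  renamingProb_le_of_update i _ fun π => card_filter_envyAt_update_le π hij hT

end EnvyProbability

/-! ### Probability calculus and the union bound -/

section Probability

variable {n m : ℕ}

theorem renamingProb_nonneg (E : (Fin n → Equiv.Perm (Fin m)) → Prop) : 0 ≤ renamingProb n m E := by
  unfold renamingProb; positivity

theorem renamingProb_mono {E F : (Fin n → Equiv.Perm (Fin m)) → Prop} (h : ∀ ρ, E ρ → F ρ) :
    renamingProb n m E ≤ renamingProb n m F := by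
  classical
  unfold renamingProb
  gcongr
  exact h _

theorem renamingProb_eq_one_sub (E : (Fin n → Equiv.Perm (Fin m)) → Prop) :
    renamingProb n m E = 1 - renamingProb n m (fun ρ => ¬ E ρ) := by
  classical
  unfold renamingProb
  have hcard : (0 : ℝ) < Fintype.card (Fin n → Equiv.Perm (Fin m)) := by
    exact_mod_cast Fintype.card_pos
  rw [eq_sub_iff_add_eq, ← add_div, div_eq_one_iff_eq hcard.ne']
  have := Finset.card_filter_add_card_filter_not (s := Finset.univ) E
  rw [Finset.card_univ] at this
  norm_cast
  convert this

/-- Right multiplication by `σ` is a bijection, so the renamed orderings are uniform whatever the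
original ones are. -/
theorem renamingProb_comp_renameOrdering (σ : Fin n → ItemOrder m)
    (E : (Fin n → Equiv.Perm (Fin m)) → Prop) :
    renamingProb n m (fun ρ => E fun i => renameOrdering (ρ i) (σ i)) = renamingProb n m E := by
  classical
  unfold renamingProb
  congr 2
  refine Finset.card_equiv (Equiv.mulRight σ) fun ρ => ?_
  simp only [Finset.mem_filter, Finset.mem_univ, true_and]
  rfl

theorem renamingProb_exists_le {α : Type*} (s : Finset α)
    (E : α → (Fin n → Equiv.Perm (Fin m)) → Prop) :
    renamingProb n m (fun ρ => ∃ a ∈ s, E a ρ) ≤ ∑ a ∈ s, renamingProb n m (E a) := by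
  classical
  unfold renamingProb
  rw [← Finset.sum_div]
  gcongr
  have : (Finset.univ.filter fun ρ : Fin n → Equiv.Perm (Fin m) => ∃ a ∈ s, E a ρ) ⊆
      s.biUnion fun a => Finset.univ.filter (E a) := by
    intro ρ hρ
    simpa using hρ
  have := (Finset.card_le_card this).trans Finset.card_biUnion_le
  norm_cast
  refine (Eq.le ?_).trans this
  congr!

theorem renamingProb_exists_envyAt_le [NeZero n] {M : ℕ} (hM : M ≤ m) :
    renamingProb n m (fun π => ∃ c : ℕ, ∃ i j : Fin n, j < i ∧ c * n + i < M ∧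
      EnvyAt π i j (c * n + i)) ≤ n * ∑ t ∈ Finset.range M, envyBound n (m - t) (t / n) 1 := by
  have h1 : renamingProb n m (fun π => ∃ c : ℕ, ∃ i j : Fin n, j < i ∧ c * n + i < M ∧
      EnvyAt π i j (c * n + i)) ≤ renamingProb n m (fun π =>
        ∃ p ∈ Finset.range M ×ˢ (Finset.univ : Finset (Fin n)),
          p.2 < Fin.ofNat n p.1 ∧ EnvyAt π (Fin.ofNat n p.1) p.2 p.1) := by
    refine renamingProb_mono ?_
    rintro π ⟨c, i, j, hij, hT, hE⟩
    refine ⟨(c * n + i, j), by simpa using hT, ?_⟩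
    simp only [ofNat_turn]
    exact ⟨hij, hE⟩
  refine h1.trans ((renamingProb_exists_le _ _).trans ?_)
  have h2 : ∀ p ∈ Finset.range M ×ˢ (Finset.univ : Finset (Fin n)),
      renamingProb n m (fun π => p.2 < Fin.ofNat n p.1 ∧ EnvyAt π (Fin.ofNat n p.1) p.2 p.1) ≤
        envyBound n (m - p.1) (p.1 / n) 1 := by
    rintro ⟨t, j⟩ hp
    simp only [Finset.mem_product, Finset.mem_range, Finset.mem_univ, and_true] at hp
    by_cases hj : j < Fin.ofNat n t
    · have e : t / n * n + (Fin.ofNat n t : Fin n) = t := Nat.div_add_mod' t n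
      have := renamingProb_envyAt_le (m := m) hj (k := t / n) (by rw [e]; omega)
      rw [e] at this
      exact (renamingProb_mono fun π h => h.2).trans this
    · have : renamingProb n m (fun π => j < Fin.ofNat n t ∧ EnvyAt π (Fin.ofNat n t) j t) = 0 := by
        simp only [renamingProb, hj, false_and, Finset.filter_false, Finset.card_empty,
          Nat.cast_zero, zero_div]
      simp only [this]
      exact envyBound_nonneg _ _ _ _
  refine (Finset.sum_le_sum h2).trans (le_of_eq ?_)
  rw [Finset.sum_product]
  simp [Finset.mul_sum]

end Probability

/-! ### Estimates for the sum of the envy bounds -/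

section Estimates

open Finset

theorem envyBound_one_eq {n : ℕ} (hn : 0 < n) (R d : ℕ) :
    envyBound n R d 1 = (d + 1) / (R + d + 1) *
      ∏ l ∈ range d, ((l + 1 + R / n : ℝ) / (l + 1 + R)) := by
  have hn' : (0 : ℝ) < n := by exact_mod_cast hn
  induction d with
  | zero =>
    simp [envyBound, Nat.add_comm 1 R]
  | succ d ih =>
    have hc := choose_add_succ_mul (d + 1) R
    have h1 : (0 : ℝ) < ((d + 1 + R).choose R : ℝ) := by
      exact_mod_cast Nat.choose_pos (by omega)
    have h2 : (0 : ℝ) < ((d + 1 + 1 + R).choose R : ℝ) := by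
      exact_mod_cast Nat.choose_pos (by omega)
    have e : envyBound n R (d + 1) 1 = envyBound n R d 1 *
        ((R + (d + 1) * n) / ((d + 1) * n) * ((d + 2) / (d + 2 + R))) := by
      unfold envyBound
      rw [prod_range_succ, show 1 + (d + 1) + R = d + 1 + 1 + R by omega,
        show 1 + d + R = d + 1 + R by omega]
      push_cast at hc
      have hc' : ((d + 1 + 1 + R).choose R : ℝ) =
          ((d + 1 + R).choose R : ℝ) * (d + 2 + R) / (d + 2) := by
        field_simp
        linarith
      rw [hc']
      generalize (∏ x ∈ range d, ((R + (x + 1) * n : ℝ) / ((x + 1) * n))) = A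
      field_simp
    rw [e, ih, prod_range_succ]
    generalize (∏ l ∈ range d, ((l + 1 + R / n : ℝ) / (l + 1 + R))) = A
    push_cast
    field_simp
    ring

theorem envyBound_one_le_prod {n : ℕ} (hn : 0 < n) (R d : ℕ) :
    envyBound n R d 1 ≤ ∏ l ∈ range d, ((l + 1 + R / n : ℝ) / (l + 1 + R)) := by
  rw [envyBound_one_eq hn]
  refine mul_le_of_le_one_left (by positivity) ?_
  rw [div_le_one (by positivity)]
  have : (0 : ℝ) ≤ R := by positivity
  linarith

theorem div_le_half {n R : ℕ} (hn : 2 ≤ n) : (R / n : ℝ) ≤ R / 2 := by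
  gcongr
  exact_mod_cast hn

/-- As `n ≥ 2` and `l + 1 ≤ R / 2`, each factor is at most `(l + 1 + R / 2) / (l + 1 + R) ≤ 2 / 3`.
-/
theorem envyBound_le_of_early {n R d : ℕ} (hn : 2 ≤ n) (hd : 2 * d ≤ R) :
    envyBound n R d 1 ≤ (d + 1) / (R + d + 1) * (2 / 3) ^ d := by
  rw [envyBound_one_eq (by omega)]
  gcongr
  have : ∏ l ∈ range d, ((l + 1 + R / n : ℝ) / (l + 1 + R)) ≤ ∏ l ∈ range d, (2 / 3 : ℝ) := by
    refine prod_le_prod (fun l _ => by positivity) fun l hl => ?_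
    have hl' : l + 1 ≤ d := mem_range.1 hl
    have h1 : ((l : ℝ) + 1) * 2 ≤ R := by exact_mod_cast (by omega : (l + 1) * 2 ≤ R)
    have h2 := div_le_half (R := R) hn
    rw [div_le_div_iff₀ (by positivity) (by norm_num)]
    linarith
  rwa [prod_const, card_range] at this

theorem envyBound_le_of_two_le {n R d : ℕ} (hn : 2 ≤ n) (hR : 2 ≤ R) :
    envyBound n R d 1 ≤ 2 / (d + 2) := by
  refine (envyBound_one_le_prod (by omega) R d).trans ?_
  have hR' : (2 : ℝ) ≤ R := by exact_mod_cast hR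
  induction d with
  | zero => simp
  | succ d ih =>
    rw [prod_range_succ]
    have h2 := div_le_half (R := R) hn
    have h3 : (d + 1 + R / n : ℝ) / (d + 1 + R) ≤ (d + 2) / (d + 3) := by
      rw [div_le_div_iff₀ (by positivity) (by positivity)]
      nlinarith
    calc _ ≤ (2 / (d + 2) : ℝ) * ((d + 2) / (d + 3)) := by gcongr
      _ = _ := by push_cast; field_simp; ring

/-- The factors are at most `(l + 4) / (l + 7)`, the value at `R = 6`, `n = 2`, and these telescope.
Cubic decay is what lets a sum over up to `m` turns stay of order `n / m` when only `n² ≤ m` is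
known. -/
theorem envyBound_le_of_six_le {n R d : ℕ} (hn : 2 ≤ n) (hR : 6 ≤ R) :
    envyBound n R d 1 ≤ 120 / ((d + 4) * (d + 5) * (d + 6)) := by
  refine (envyBound_one_le_prod (by omega) R d).trans ?_
  have hR' : (6 : ℝ) ≤ R := by exact_mod_cast hR
  induction d with
  | zero => norm_num
  | succ d ih =>
    rw [prod_range_succ]
    have h2 := div_le_half (R := R) hn
    have h3 : (d + 1 + R / n : ℝ) / (d + 1 + R) ≤ (d + 4) / (d + 7) := by
      rw [div_le_div_iff₀ (by positivity) (by positivity)]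
      nlinarith
    calc _ ≤ (120 / ((d + 4) * (d + 5) * (d + 6)) : ℝ) * ((d + 4) / (d + 7)) := by gcongr
      _ = _ := by push_cast; field_simp; ring

theorem envyBound_last_le {n d : ℕ} (hn : 2 ≤ n) :
    envyBound n 1 d 1 ≤ (2 / (d + 2) : ℝ) ^ (((n : ℝ) - 1) / n) := by
  refine (envyBound_one_le_prod (by omega) 1 d).trans ?_
  have hn' : (2 : ℝ) ≤ n := by exact_mod_cast hn
  have hn0 : (0 : ℝ) < n := by linarith
  set a : ℝ := ((n : ℝ) - 1) / n with ha
  have ha0 : 0 ≤ a := div_nonneg (by linarith) hn0.le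
  have ha1 : a ≤ 1 := by rw [ha, div_le_one hn0]; linarith
  have han : 1 / (n : ℝ) = 1 - a := by rw [ha]; field_simp; ring
  induction d with
  | zero => simp
  | succ d ih =>
    rw [prod_range_succ]
    have h3 : (d + 1 + (1 : ℕ) / n : ℝ) / (d + 1 + (1 : ℕ)) ≤ ((d + 2) / (d + 3) : ℝ) ^ a := by
      -- The factor is `1 - a / (d + 2)`, at most `1 / (1 + a / (d + 2))`; Bernoulli's inequality
      -- compares this with `((d + 2) / (d + 3)) ^ a`, which telescopes.
      have hB := rpow_one_add_le_one_add_mul_self (s := 1 / (d + 2 : ℝ))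
        (by have : (0 : ℝ) ≤ 1 / (d + 2) := by positivity
            linarith) ha0 ha1
      have e : ((d + 2) / (d + 3) : ℝ) ^ a = ((1 + 1 / (d + 2 : ℝ)) ^ a)⁻¹ := by
        rw [← Real.inv_rpow (by positivity)]
        congr 1
        field_simp
        ring
      have hpos : (0 : ℝ) < (1 + 1 / (d + 2 : ℝ)) ^ a := by positivity
      rw [e, Nat.cast_one, han, le_inv_comm₀ (div_pos (by linarith) (by positivity)) hpos, inv_div]
      refine hB.trans ?_
      rw [le_div_iff₀ (by linarith)]
      have : (1 + a * (1 / (d + 2 : ℝ))) = (d + 2 + a) / (d + 2) := by field_simp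
      rw [this, div_mul_eq_mul_div, div_le_iff₀ (by positivity)]
      nlinarith
    calc _ ≤ (2 / (d + 2) : ℝ) ^ a * ((d + 2) / (d + 3) : ℝ) ^ a := by
          gcongr
      _ = _ := by
          rw [← Real.mul_rpow (by positivity) (by positivity)]
          congr 1
          push_cast; field_simp; ring

theorem sum_succ_mul_two_thirds_pow_le (N : ℕ) :
    ∑ d ∈ range N, ((d : ℝ) + 1) * (2 / 3) ^ d ≤ 9 := by
  have : ∑ d ∈ range N, ((d : ℝ) + 1) * (2 / 3) ^ d = 9 - (3 * N + 9) * (2 / 3) ^ N := by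
    induction N with
    | zero => simp
    | succ N ih => rw [sum_range_succ, ih]; push_cast; ring
  rw [this]
  have : (0 : ℝ) ≤ (3 * N + 9) * (2 / 3) ^ N := by positivity
  linarith

theorem sum_div_le {n : ℕ} (hn : 0 < n) (M : ℕ) (g : ℕ → ℝ) (hg : ∀ d, 0 ≤ g d) :
    ∑ t ∈ range M, g (t / n) ≤ n * ∑ d ∈ range M, g d := by
  have h : ∑ t ∈ range M, g (t / n) ≤ ∑ p ∈ range M ×ˢ range n, g p.1 := by
    rw [← sum_image (f := fun p : ℕ × ℕ => g p.1) (g := fun t => (t / n, t % n)) (s := range M)]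
    · refine sum_le_sum_of_subset_of_nonneg ?_ fun p _ _ => hg _
      intro p hp
      obtain ⟨t, ht, rfl⟩ := mem_image.1 hp
      exact mem_product.2 ⟨mem_range.2 ((Nat.div_le_self _ _).trans_lt (mem_range.1 ht)),
        mem_range.2 (Nat.mod_lt _ hn)⟩
    · intro t _ t' _ h
      have h1 := (Prod.ext_iff.1 h).1
      have h2 := (Prod.ext_iff.1 h).2
      simp only at h1 h2
      rw [← Nat.div_add_mod t n, ← Nat.div_add_mod t' n, h1, h2]
  refine h.trans (le_of_eq ?_)
  rw [sum_product]
  simp [mul_sum]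

theorem sum_envyBound_le {n m : ℕ} (hn : 2 ≤ n) (hm : n ^ 2 ≤ m) :
    ∑ t ∈ range (m - 1), envyBound n (m - t) (t / n) 1 ≤ 1000 * (n / m : ℝ) := by
  have hm0 : 0 < m := lt_of_lt_of_le (by positivity) hm
  have hmR : (0 : ℝ) < m := by exact_mod_cast hm0
  have hnR : (0 : ℝ) < n := by exact_mod_cast (by omega : 0 < n)
  have hterm : ∀ t ∈ range (m - 1), envyBound n (m - t) (t / n) 1 ≤
      2 / m * ((((t / n : ℕ) : ℝ) + 1) * (2 / 3) ^ (t / n)) + 960 * (n / m : ℝ) ^ 3 +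
        (if m - t < 6 then 4 * (n / m : ℝ) else 0) := by
    intro t ht
    have ht := mem_range.1 ht
    have hA : (0 : ℝ) ≤ 2 / m * ((((t / n : ℕ) : ℝ) + 1) * (2 / 3) ^ (t / n)) := by positivity
    have hB : (0 : ℝ) ≤ 960 * (n / m : ℝ) ^ 3 := by positivity
    have hC : (0 : ℝ) ≤ if m - t < 6 then 4 * (n / m : ℝ) else 0 := by
      split_ifs <;> positivity
    -- The three summands of the majorant cover, respectively, the first half of the picks, later
    -- picks with at least six items left, and those with two to five left.
    by_cases h2 : 2 * t ≤ m
    · have hdiv : t / n ≤ t / 2 := Nat.div_le_div_left hn (by norm_num)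
      have h := envyBound_le_of_early (R := m - t) (d := t / n) hn (by omega)
      have h3 : (((t / n : ℕ) : ℝ) + 1) / (((m - t : ℕ) : ℝ) + ((t / n : ℕ) : ℝ) + 1) ≤
          2 / m * (((t / n : ℕ) : ℝ) + 1) := by
        have h4 : (m : ℝ) ≤ 2 * ((m - t : ℕ) : ℝ) := by exact_mod_cast (by omega : m ≤ 2 * (m - t))
        rw [div_mul_eq_mul_div, div_le_div_iff₀ (by positivity) hmR]
        have : (0 : ℝ) ≤ ((t / n : ℕ) : ℝ) := by positivity
        nlinarith
      have h5 := mul_le_mul_of_nonneg_right h3 (by positivity : (0 : ℝ) ≤ (2 / 3) ^ (t / n))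
      rw [mul_assoc] at h5
      linarith
    · have hd : (m : ℝ) / (2 * n) ≤ ((t / n : ℕ) : ℝ) + 1 := by
        rw [div_le_iff₀ (by positivity)]
        have h3 : t < (t / n + 1) * n := by
          rw [mul_comm]; exact Nat.lt_mul_div_succ t (by omega)
        have h4 : m ≤ (t / n + 1) * (2 * n) := by nlinarith
        exact_mod_cast h4
      have hx : (0 : ℝ) < (m : ℝ) / (2 * n) := by positivity
      have hinv : (n / m : ℝ) = ((m : ℝ) / (2 * n))⁻¹ / 2 := by field_simp
      set x : ℝ := (m : ℝ) / (2 * n)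
      by_cases h6 : m - t < 6
      · have h := envyBound_le_of_two_le (R := m - t) (d := t / n) hn (by omega)
        have h7 : (2 / (((t / n : ℕ) : ℝ) + 2)) ≤ 4 * (n / m : ℝ) := by
          rw [hinv]
          calc _ ≤ 2 / x := by gcongr; linarith
            _ = _ := by field_simp; norm_num
        rw [if_pos h6]
        linarith
      · have h := envyBound_le_of_six_le (R := m - t) (d := t / n) hn (by omega)
        have h7 : (120 / ((((t / n : ℕ) : ℝ) + 4) * (((t / n : ℕ) : ℝ) + 5) *
            (((t / n : ℕ) : ℝ) + 6))) ≤ 960 * (n / m : ℝ) ^ 3 := by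
          rw [hinv]
          calc _ ≤ 120 / (x * x * x) := by gcongr <;> linarith
            _ = _ := by field_simp; norm_num
        linarith
  refine (sum_le_sum hterm).trans ?_
  rw [sum_add_distrib, sum_add_distrib, ← mul_sum, sum_const, card_range, nsmul_eq_mul,
    ← sum_filter, sum_const, nsmul_eq_mul]
  have h1 := sum_div_le (n := n) (by omega) (m - 1) (fun d => ((d : ℝ) + 1) * (2 / 3) ^ d)
    (fun d => by positivity)
  have h2 := sum_succ_mul_two_thirds_pow_le (m - 1)
  have h3 : 2 / (m : ℝ) * ∑ t ∈ range (m - 1), (((t / n : ℕ) : ℝ) + 1) * (2 / 3) ^ (t / n) ≤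
      2 / m * (n * 9) := by
    gcongr
    exact h1.trans (by gcongr)
  have h4 : (((m - 1 : ℕ) : ℝ)) * (960 * (n / m : ℝ) ^ 3) ≤ 960 * (n / m : ℝ) := by
    have h5 : ((m - 1 : ℕ) : ℝ) ≤ m := by exact_mod_cast Nat.sub_le m 1
    have h6 : ((n : ℝ)) ^ 2 ≤ m := by exact_mod_cast hm
    calc (((m - 1 : ℕ) : ℝ)) * (960 * (n / m : ℝ) ^ 3) ≤ m * (960 * (n / m : ℝ) ^ 3) := by gcongr
      _ = 960 * (n / m : ℝ) * (n ^ 2 / m) := by field_simp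
      _ ≤ 960 * (n / m : ℝ) * 1 := by
        gcongr
        rwa [div_le_one hmR]
      _ = _ := mul_one _
  have h7 : (((range (m - 1)).filter fun t => m - t < 6).card : ℝ) ≤ 5 := by
    have : (range (m - 1)).filter (fun t => m - t < 6) ⊆ Ico (m - 5) m := by
      intro t ht
      obtain ⟨h, h'⟩ := mem_filter.1 ht
      have := mem_range.1 h
      exact mem_Ico.2 ⟨by omega, by omega⟩
    have := card_le_card this
    rw [Nat.card_Ico] at this
    exact_mod_cast (by omega : ((range (m - 1)).filter fun t => m - t < 6).card ≤ 5)
  have h8 : (((range (m - 1)).filter fun t => m - t < 6).card : ℝ) * (4 * (n / m : ℝ)) ≤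
      5 * (4 * (n / m : ℝ)) := by gcongr
  have h9 : 2 / (m : ℝ) * (n * 9) = 18 * (n / m : ℝ) := by ring
  have h10 : (0 : ℝ) ≤ n / m := by positivity
  linarith

theorem sq_div_rpow_le {n m : ℕ} (hn : 2 ≤ n) (hm : 0 < m) :
    (n : ℝ) ^ 2 / (m : ℝ) ^ (((n : ℝ) - 1) / n) ≤
      3 * ((n : ℝ) ^ 2 / m + n * Real.log m / (m : ℝ) ^ (((n : ℝ) - 1) / n)) := by
  have hnR : (0 : ℝ) < n := by exact_mod_cast (by omega : 0 < n)
  have hmR : (0 : ℝ) < m := by exact_mod_cast hm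
  have hlog : 0 ≤ Real.log m := Real.log_natCast_nonneg m
  have hpow : (0 : ℝ) < (m : ℝ) ^ (((n : ℝ) - 1) / n) := by positivity
  have hA : (0 : ℝ) ≤ (n : ℝ) ^ 2 / m := by positivity
  have hB : (0 : ℝ) ≤ n * Real.log m / (m : ℝ) ^ (((n : ℝ) - 1) / n) := by positivity
  -- If `n ≤ log m`, the logarithmic term dominates. Otherwise `m ^ (1 / n) ≤ e < 3`, and the left
  -- side is `m ^ (1 / n)` times `n² / m`.
  by_cases h : (n : ℝ) ≤ Real.log m
  · have : (n : ℝ) ^ 2 / (m : ℝ) ^ (((n : ℝ) - 1) / n) ≤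
        n * Real.log m / (m : ℝ) ^ (((n : ℝ) - 1) / n) := by
      gcongr
      nlinarith
    linarith
  · have e : (m : ℝ) = (m : ℝ) ^ (((n : ℝ) - 1) / n) * (m : ℝ) ^ (1 / (n : ℝ)) := by
      rw [← Real.rpow_add hmR]
      have : ((n : ℝ) - 1) / n + 1 / n = 1 := by field_simp; ring
      rw [this, Real.rpow_one]
    have h1 : (m : ℝ) ^ (1 / (n : ℝ)) ≤ 3 := by
      rw [Real.rpow_def_of_pos hmR]
      refine le_trans (Real.exp_le_exp.2 (?_ : _ ≤ (1 : ℝ))) ?_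
      · rw [mul_one_div, div_le_one hnR]; exact (not_le.1 h).le
      · exact Real.exp_one_lt_three.le
    have h2 : (n : ℝ) ^ 2 / (m : ℝ) ^ (((n : ℝ) - 1) / n) =
        (m : ℝ) ^ (1 / (n : ℝ)) * ((n : ℝ) ^ 2 / m) := by
      rw [div_eq_iff hpow.ne']
      calc (n : ℝ) ^ 2 = (n : ℝ) ^ 2 / m * m := by field_simp
        _ = (n : ℝ) ^ 2 / m *
            ((m : ℝ) ^ (((n : ℝ) - 1) / n) * (m : ℝ) ^ (1 / (n : ℝ))) := by rw [← e]
        _ = _ := by ring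
    rw [h2]
    nlinarith

end Estimates

/-! ### Fairness of Round-Robin with high probability -/

section RoundRobinFairness

open Finset

variable {n m : ℕ} [NeZero n]

theorem renamingProb_not_isSDEFX_le (hn : 2 ≤ n) (hm : n ^ 2 ≤ m) :
    renamingProb n m (fun π => ¬ (roundRobin π).IsSDEFX π) ≤ 1000 * ((n : ℝ) ^ 2 / m) := by
  have h1 := renamingProb_exists_envyAt_le (n := n) (m := m) (Nat.sub_le m 1)
  have h2 := sum_envyBound_le hn hm
  calc _ ≤ renamingProb n m (fun π => ∃ c : ℕ, ∃ i j : Fin n, j < i ∧ c * n + i < m - 1 ∧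
        EnvyAt π i j (c * n + i)) := renamingProb_mono fun π h => by
          obtain ⟨c, i, j, h1, h2, h3⟩ := exists_envyAt_of_not_isSDEFX π h
          exact ⟨c, i, j, h1, by omega, h3⟩
    _ ≤ _ := h1
    _ ≤ n * (1000 * (n / m : ℝ)) := by gcongr
    _ = _ := by ring

theorem renamingProb_not_isSDEF_le (hn : 2 ≤ n) (hm : n ^ 2 ≤ m) (hdvd : n ∣ m) :
    renamingProb n m (fun π => ¬ (roundRobin π).IsSDEF π) ≤
      1010 * ((n : ℝ) ^ 2 / m + n * Real.log m / (m : ℝ) ^ (((n : ℝ) - 1) / n)) := by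
  have hm0 : 0 < m := lt_of_lt_of_le (by positivity) hm
  have hnR : (0 : ℝ) < n := by exact_mod_cast (by omega : 0 < n)
  have hmR : (0 : ℝ) < m := by exact_mod_cast hm0
  have h1 := renamingProb_exists_envyAt_le (n := n) (m := m) le_rfl
  have h2 := sum_envyBound_le hn hm
  have h3 := sq_div_rpow_le hn hm0
  have hlast : envyBound n 1 ((m - 1) / n) 1 ≤ 2 * n / (m : ℝ) ^ (((n : ℝ) - 1) / n) := by
    refine (envyBound_last_le hn).trans ?_
    have ha0 : (0 : ℝ) ≤ ((n : ℝ) - 1) / n :=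
      div_nonneg (by have : (2 : ℝ) ≤ n := by exact_mod_cast hn
                     linarith) hnR.le
    have ha1 : ((n : ℝ) - 1) / n ≤ 1 := by rw [div_le_one hnR]; linarith
    have h4 : (m : ℝ) ≤ (((m - 1) / n : ℕ) + 1) * n := by
      have := Nat.lt_mul_div_succ (m - 1) (by omega : 0 < n)
      have h5 : m ≤ ((m - 1) / n + 1) * n := by rw [mul_comm]; omega
      exact_mod_cast h5
    calc (2 / (((m - 1) / n : ℕ) + 2 : ℝ)) ^ (((n : ℝ) - 1) / n)
        ≤ (2 * n / m : ℝ) ^ (((n : ℝ) - 1) / n) := by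
          refine Real.rpow_le_rpow (by positivity) ?_ ha0
          rw [div_le_div_iff₀ (by positivity) hmR]
          nlinarith
      _ = (2 * n : ℝ) ^ (((n : ℝ) - 1) / n) / (m : ℝ) ^ (((n : ℝ) - 1) / n) :=
          Real.div_rpow (by positivity) hmR.le _
      _ ≤ _ := by
          gcongr
          refine (Real.rpow_le_rpow_of_exponent_le ?_ ha1).trans (Real.rpow_one _).le
          have : (1 : ℝ) ≤ n := by exact_mod_cast (by omega : 1 ≤ n)
          linarith
  -- The last pick, with `R = 1`, decays too slowly for `sum_envyBound_le` and is estimated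
  -- separately.
  have hsplit : ∑ t ∈ range m, envyBound n (m - t) (t / n) 1 =
      ∑ t ∈ range (m - 1), envyBound n (m - t) (t / n) 1 + envyBound n 1 ((m - 1) / n) 1 := by
    have e : range m = range (m - 1 + 1) := by rw [Nat.sub_add_cancel hm0]
    rw [e, sum_range_succ, show m - (m - 1) = 1 by omega]
  have hB : (0 : ℝ) ≤ n * Real.log m / (m : ℝ) ^ (((n : ℝ) - 1) / n) := by
    have := Real.log_natCast_nonneg m
    positivity
  have hA : (0 : ℝ) ≤ (n : ℝ) ^ 2 / m := by positivity
  calc _ ≤ renamingProb n m (fun π => ∃ c : ℕ, ∃ i j : Fin n, j < i ∧ c * n + i < m ∧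
        EnvyAt π i j (c * n + i)) :=
          renamingProb_mono fun π h => exists_envyAt_of_not_isSDEF π hdvd h
    _ ≤ _ := h1
    _ ≤ n * (1000 * (n / m : ℝ) + 2 * n / (m : ℝ) ^ (((n : ℝ) - 1) / n)) := by
        rw [hsplit]; gcongr
    _ = 1000 * ((n : ℝ) ^ 2 / m) + 2 * ((n : ℝ) ^ 2 / (m : ℝ) ^ (((n : ℝ) - 1) / n)) := by ring
    _ ≤ _ := by linarith

theorem one_le_sq_div {n m : ℕ} (hm0 : 0 < m) (hm : m < n ^ 2) : 1 ≤ (n : ℝ) ^ 2 / m := by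
  rw [one_le_div (by exact_mod_cast hm0)]
  exact_mod_cast hm.le

theorem le_renamingProb_isSDEF (hn : 2 ≤ n) (hm0 : 0 < m) (hdvd : n ∣ m)
    (v : Fin n → BundleValuation m) (σ : Fin n → ItemOrder m)
    (hv : ∀ i, OrderConsistentWith (σ i) (v i)) :
    1 - 1010 * ((n : ℝ) ^ 2 / m + n * Real.log m / (m : ℝ) ^ (((n : ℝ) - 1) / n)) ≤
      renamingProb n m (fun ρ =>
        (roundRobin (fun i => renameOrdering (ρ i) (σ i))).IsSDEF
          (fun i => renameOrdering (ρ i) (σ i)) ∧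
        (roundRobin (fun i => renameOrdering (ρ i) (σ i))).IsEF
          (fun i => rename (ρ i) (v i))) := by
  rcases le_or_gt (n ^ 2) m with hm | hm
  · have h1 := renamingProb_not_isSDEF_le hn hm hdvd
    rw [← renamingProb_comp_renameOrdering σ] at h1
    refine le_trans ?_ (renamingProb_mono fun ρ h => ⟨h, h.isEF hv⟩)
    rw [renamingProb_eq_one_sub]
    linarith
  · refine le_trans ?_ (renamingProb_nonneg _)
    have := one_le_sq_div hm0 hm
    have hB : (0 : ℝ) ≤ n * Real.log m / (m : ℝ) ^ (((n : ℝ) - 1) / n) := by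
      have := Real.log_natCast_nonneg m
      positivity
    linarith

theorem le_renamingProb_isSDEFX (hn : 2 ≤ n) (hm0 : 0 < m)
    (v : Fin n → BundleValuation m) (σ : Fin n → ItemOrder m)
    (hv : ∀ i, OrderConsistentWith (σ i) (v i)) :
    1 - 1000 * ((n : ℝ) ^ 2 / m) ≤
      renamingProb n m (fun ρ =>
        (roundRobin (fun i => renameOrdering (ρ i) (σ i))).IsSDEFX
          (fun i => renameOrdering (ρ i) (σ i)) ∧
        (roundRobin (fun i => renameOrdering (ρ i) (σ i))).IsEFX
          (fun i => rename (ρ i) (v i))) := by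
  rcases le_or_gt (n ^ 2) m with hm | hm
  · have h1 := renamingProb_not_isSDEFX_le hn hm
    rw [← renamingProb_comp_renameOrdering σ] at h1
    refine le_trans ?_ (renamingProb_mono fun ρ h => ⟨h, h.isEFX hv⟩)
    rw [renamingProb_eq_one_sub]
    linarith
  · refine le_trans ?_ (renamingProb_nonneg _)
    have := one_le_sq_div hm0 hm
    linarith

end RoundRobinFairness

/-! ### Birthday bound for coinciding favourite items -/

section Collision

open Finset

variable {n m : ℕ}

theorem card_perm_apply_eq (a b : Fin m) :
    m * #{ρ : Equiv.Perm (Fin m) | ρ a = b} = Fintype.card (Equiv.Perm (Fin m)) := by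
  have h : ∀ c : Fin m, #{ρ : Equiv.Perm (Fin m) | ρ a = c} =
      #{ρ : Equiv.Perm (Fin m) | ρ a = b} := fun c => by
    refine card_equiv (Equiv.mulLeft (Equiv.swap c b)) fun ρ => ?_
    simp only [mem_filter, mem_univ, true_and, Equiv.coe_mulLeft, Equiv.Perm.mul_apply]
    rw [Equiv.swap_apply_eq_iff, Equiv.swap_apply_right]
  have h1 := card_eq_sum_card_fiberwise (s := univ) (t := univ)
    (f := fun ρ : Equiv.Perm (Fin m) => ρ a) (fun _ _ => by simp)
  rw [sum_congr rfl fun c _ => h c, sum_const, smul_eq_mul, card_univ, card_univ,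
    Fintype.card_fin] at h1
  exact h1.symm

theorem renamingProb_injective (hm : 0 < m) (a : Fin n → Fin m) :
    renamingProb n m (fun ρ => Function.Injective fun i => ρ i (a i)) =
      (m.descFactorial n : ℝ) / (m : ℝ) ^ n := by
  classical
  have hfib : ∀ f : Fin n → Fin m,
      (m : ℝ) ^ n * #{ρ : Fin n → Equiv.Perm (Fin m) | (fun i => ρ i (a i)) = f} =
        Fintype.card (Fin n → Equiv.Perm (Fin m)) := by
    intro f
    have e : ({ρ : Fin n → Equiv.Perm (Fin m) | (fun i => ρ i (a i)) = f} : Finset _) =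
        Fintype.piFinset fun i => {τ : Equiv.Perm (Fin m) | τ (a i) = f i} := by
      ext ρ
      simp [funext_iff]
    have h1 : m ^ n * ∏ i : Fin n, #{τ : Equiv.Perm (Fin m) | τ (a i) = f i} =
        Fintype.card (Fin n → Equiv.Perm (Fin m)) := by
      calc _ = ∏ i : Fin n, m * #{τ : Equiv.Perm (Fin m) | τ (a i) = f i} := by
            rw [prod_mul_distrib, prod_const, card_univ, Fintype.card_fin]
        _ = _ := by
            rw [prod_congr rfl fun i _ => card_perm_apply_eq (a i) (f i), prod_const, card_univ,
              Fintype.card_fin, Fintype.card_fun, Fintype.card_fin]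
    rw [e, Fintype.card_piFinset]
    exact_mod_cast h1
  have hsum : (#{ρ : Fin n → Equiv.Perm (Fin m) | Function.Injective fun i => ρ i (a i)} : ℝ) =
      ∑ f : Fin n → Fin m with Function.Injective f,
        (#{ρ : Fin n → Equiv.Perm (Fin m) | (fun i => ρ i (a i)) = f} : ℝ) := by
    have h1 := card_eq_sum_card_fiberwise
      (s := {ρ : Fin n → Equiv.Perm (Fin m) | Function.Injective fun i => ρ i (a i)})
      (t := {f : Fin n → Fin m | Function.Injective f}) (f := fun ρ i => ρ i (a i))
      (fun ρ hρ => by simpa using hρ)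
    rw [h1]
    push_cast
    refine sum_congr rfl fun f hf => ?_
    congr 2
    ext ρ
    simp only [mem_filter, mem_univ, true_and] at hf ⊢
    exact ⟨fun h => h.2, fun h => ⟨h ▸ hf, h⟩⟩
  have hinj : #{f : Fin n → Fin m | Function.Injective f} = m.descFactorial n := by
    have h1 := Fintype.card_embedding_eq (α := Fin n) (β := Fin m)
    rw [Fintype.card_fin, Fintype.card_fin] at h1
    rw [← h1, ← Fintype.card_congr (Equiv.subtypeInjectiveEquivEmbedding (Fin n) (Fin m)),
      Fintype.card_subtype]
  have hmn : (0 : ℝ) < (m : ℝ) ^ n := by positivity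
  have hcard : (0 : ℝ) < Fintype.card (Fin n → Equiv.Perm (Fin m)) := by
    exact_mod_cast Fintype.card_pos
  have hmul : (m : ℝ) ^ n *
      (#{ρ : Fin n → Equiv.Perm (Fin m) | Function.Injective fun i => ρ i (a i)} : ℝ) =
      m.descFactorial n * Fintype.card (Fin n → Equiv.Perm (Fin m)) := by
    rw [hsum, mul_sum, sum_congr rfl fun f _ => hfib f, sum_const, nsmul_eq_mul, hinj]
  unfold renamingProb
  rw [div_eq_div_iff hcard.ne' hmn.ne', ← hmul, mul_comm]
  congr!

theorem descFactorial_div_pow_le (hm : 0 < m) (hnm : n ≤ m) :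
    (m.descFactorial n : ℝ) / (m : ℝ) ^ n ≤ Real.exp (-(n * (n - 1) / (2 * m))) := by
  have hmR : (0 : ℝ) < m := by exact_mod_cast hm
  have h1 : (m.descFactorial n : ℝ) / (m : ℝ) ^ n = ∏ i ∈ range n, (1 - i / m : ℝ) := by
    rw [Nat.descFactorial_eq_prod_range]
    push_cast
    rw [← card_range n, ← prod_const, card_range, ← prod_div_distrib]
    refine prod_congr rfl fun i hi => ?_
    rw [Nat.cast_sub ((mem_range.1 hi).le.trans hnm)]
    field_simp
  have h2 : ∑ i ∈ range n, (-(i / m : ℝ)) = -(n * (n - 1) / (2 * m)) := by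
    have h3 : ∑ i ∈ range n, (i : ℝ) = n * (n - 1) / 2 := by
      clear h1 hnm
      induction n with
      | zero => simp
      | succ n ih => rw [sum_range_succ, ih]; push_cast; ring
    rw [sum_neg_distrib, ← sum_div, h3]
    field_simp
  rw [h1, ← h2, Real.exp_sum]
  refine prod_le_prod (fun i hi => ?_) fun i _ => ?_
  · rw [sub_nonneg, div_le_one hmR]
    exact_mod_cast (mem_range.1 hi).le.trans hnm
  · have := Real.add_one_le_exp (-(i / m : ℝ))
    linarith

theorem min_le_renamingProb_not_injective (hn : 2 ≤ n) (hm : n ≤ m) (a : Fin n → Fin m) :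
    1 / 5 * min ((n : ℝ) ^ 2 / m) 1 ≤
      renamingProb n m (fun ρ => ¬ Function.Injective fun i => ρ i (a i)) := by
  have hm0 : 0 < m := by omega
  have hmR : (0 : ℝ) < m := by exact_mod_cast hm0
  have hnR : (2 : ℝ) ≤ n := by exact_mod_cast hn
  have h1 := renamingProb_eq_one_sub (n := n) (m := m)
    (fun ρ => Function.Injective fun i => ρ i (a i))
  rw [renamingProb_injective hm0] at h1
  have h2 := descFactorial_div_pow_le hm0 hm
  set x : ℝ := (n : ℝ) ^ 2 / m with hx
  have hx0 : 0 ≤ x := by positivity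
  have h3 : Real.exp (-(n * (n - 1) / (2 * m))) ≤ (1 + x / 4)⁻¹ := by
    rw [Real.exp_neg]
    -- This is `n - 1 ≥ n / 2`. With `exp (-y) ≤ 1 / (1 + y)` the collision probability is at least
    -- `x / (4 + x)`, whence the constant `1 / 5`.
    have h4 : x / 4 ≤ n * (n - 1) / (2 * m) := by
      rw [hx, div_div, div_le_div_iff₀ (by positivity) (by positivity)]
      have : 0 ≤ (m : ℝ) * n * (n - 2) := mul_nonneg (by positivity) (by linarith)
      nlinarith
    have h5 := Real.add_one_le_exp ((n : ℝ) * (n - 1) / (2 * m))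
    gcongr
    linarith
  have h4 : 1 / 5 * min x 1 ≤ 1 - (1 + x / 4)⁻¹ := by
    have e : 1 - (1 + x / 4)⁻¹ = x / (4 + x) := by field_simp; ring
    rw [e, le_div_iff₀ (by positivity)]
    rcases le_total x 1 with h | h
    · rw [min_eq_left h]; nlinarith
    · rw [min_eq_right h]; linarith
  linarith

end Collision

/-! ### Colliding favourites exclude fair allocations -/

section Impossibility

open Finset

variable {n m : ℕ}

theorem orderEmbOfFin_zero_le {P : Finset (Fin m)} (h : 0 < P.card) {y : Fin m} (hy : y ∈ P) :
    P.orderEmbOfFin rfl ⟨0, h⟩ ≤ y := by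
  have : y ∈ Set.range (P.orderEmbOfFin rfl) := by
    rw [range_orderEmbOfFin]; exact hy
  obtain ⟨l, rfl⟩ := this
  exact (P.orderEmbOfFin rfl).monotone (Fin.mk_le_of_le_val (Nat.zero_le _))

/-- If `A ⪰ˢᵈ B`, then some item of `A` is at least as good as any given item of `B`. -/
theorem SDGe.exists_le {π : ItemOrder m} {A B : Finset (Fin m)} (h : SDGe π A B) {b : Fin m}
    (hb : b ∈ B) : ∃ a ∈ A, π.symm a ≤ π.symm b := by
  obtain ⟨hc, hk⟩ := h
  have hb' : π.symm b ∈ positions π B := mem_map.2 ⟨b, hb, rfl⟩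
  have hpos : 0 < (positions π B).card := card_pos.2 ⟨_, hb'⟩
  have h1 := (hk ⟨0, hpos⟩).trans (orderEmbOfFin_zero_le hpos hb')
  have h2 := orderEmbOfFin_mem (positions π A) rfl (Fin.castLE hc ⟨0, hpos⟩)
  obtain ⟨a, ha, e⟩ := mem_map.1 h2
  refine ⟨a, ha, ?_⟩
  rw [← e] at h1
  exact h1

theorem SDGe.card_le {π : ItemOrder m} {A B : Finset (Fin m)} (h : SDGe π A B) :
    B.card ≤ A.card := by
  obtain ⟨hc, -⟩ := h
  simpa [positions] using hc

theorem unitDemand_le_of_forall {w : Fin m → ℝ} (hw : ∀ g, 0 ≤ w g) {A B : Finset (Fin m)}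
    (h : ∀ b ∈ B, ∃ a ∈ A, w b ≤ w a) : unitDemand w B ≤ unitDemand w A := by
  unfold unitDemand
  by_cases hB : B.Nonempty
  · obtain ⟨b, hb⟩ := id hB
    obtain ⟨a, ha, -⟩ := h b hb
    rw [dif_pos hB, dif_pos ⟨a, ha⟩, sup'_le_iff]
    intro b hb
    obtain ⟨a, ha, hle⟩ := h b hb
    exact hle.trans (le_sup' w ha)
  · rw [dif_neg hB]
    split_ifs with hA
    · obtain ⟨a, ha⟩ := id hA
      exact (hw a).trans (le_sup' w ha)
    · exact le_rfl

theorem orderConsistent_unitDemand {w : Fin m → ℝ} (hw : ∀ g, 0 ≤ w g) :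
    OrderConsistent (unitDemand w) := by
  refine ⟨Tuple.sort fun g => -w g, fun A B h => unitDemand_le_of_forall hw fun b hb => ?_⟩
  obtain ⟨a, ha, hle⟩ := h.exists_le hb
  refine ⟨a, ha, ?_⟩
  have := Tuple.monotone_sort (fun g => -w g) hle
  simpa using this

/-- Two agents with the same unique most valuable item cannot both be satisfied. -/
theorem not_exists_isEF_of_not_injective (hm : 2 ≤ m) {w : Fin n → Fin m → ℝ}
    (hw : ∀ i g, 0 ≤ w i g) {a : Fin n → Fin m} (ha : ∀ i g, g ≠ a i → w i g < w i (a i))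
    {ρ : Fin n → Equiv.Perm (Fin m)} (h : ¬ Function.Injective fun i => ρ i (a i)) :
    ¬ ∃ A : Allocation n m, A.IsEF (fun i => rename (ρ i) (unitDemand (w i))) := by
  rintro ⟨A, hA⟩
  have hlt : ∀ i l : Fin n, i ≠ l → ρ l (a l) ∈ A.bundle i → False := by
    intro i l hil hmem
    have h1 := hA l i
    refine absurd h1 (not_le.2 ?_)
    -- Needed if agent `l` receives nothing, since the empty bundle is worth 0; a second item makes
    -- the strict maximum positive.
    have hpos : 0 < w l (a l) := by
      have : Nontrivial (Fin m) := Fin.nontrivial_iff_two_le.2 hm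
      obtain ⟨g, hg⟩ := exists_ne (a l)
      exact (hw l g).trans_lt (ha l g hg)
    have hmem' : a l ∈ (A.bundle i).map (ρ l).symm.toEmbedding :=
      mem_map.2 ⟨_, hmem, by simp⟩
    have hge : w l (a l) ≤ rename (ρ l) (unitDemand (w l)) (A.bundle i) := by
      unfold rename unitDemand
      rw [dif_pos ⟨_, hmem'⟩]
      exact le_sup' (w l) hmem'
    refine lt_of_lt_of_le ?_ hge
    change rename (ρ l) (unitDemand (w l)) (A.bundle l) < _
    unfold rename unitDemand
    split_ifs with hne
    · rw [sup'_lt_iff]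
      intro g hg
      refine ha l g ?_
      rintro rfl
      obtain ⟨g', hg', e⟩ := mem_map.1 hg
      have : g' = ρ l (a l) := by rw [← e]; simp
      exact disjoint_left.1 (A.disjoint i l hil) hmem (this ▸ hg')
    · exact hpos
  simp only [Function.Injective, not_forall] at h
  obtain ⟨i, l, he, hil⟩ := h
  obtain ⟨q, hq⟩ := A.cover (ρ i (a i))
  by_cases hqi : q = i
  · subst hqi
    exact hlt q l hil (he ▸ hq)
  · exact hlt q i hqi hq

theorem not_exists_isSDEFX_of_not_injective (hm : 2 * n ≤ m) (h0 : 0 < m)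
    {π : Fin n → ItemOrder m} (h : ¬ Function.Injective fun i => π i ⟨0, h0⟩) :
    ¬ ∃ A : Allocation n m, A.IsSDEFX π := by
  rintro ⟨A, hA⟩
  have hlt : ∀ i l : Fin n, i ≠ l → π l ⟨0, h0⟩ ∈ A.bundle i → False := by
    intro i l hil hmem
    -- Removing any other item from this bundle would leave `l`'s favourite in it, and no item of
    -- `l` is as good. Agent `i` then has one item, so every bundle has at most two and at most `2 n
    -- - 1 < m` items are allocated.
    have hsingle : A.bundle i = {π l ⟨0, h0⟩} := by
      refine eq_singleton_iff_unique_mem.2 ⟨hmem, fun g hg => ?_⟩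
      by_contra hne
      obtain ⟨a, ha, hle⟩ := (hA l i g hg).exists_le (mem_erase.2 ⟨Ne.symm hne, hmem⟩)
      rw [Equiv.symm_apply_apply] at hle
      have h1 : (π l).symm a = ⟨0, h0⟩ := le_antisymm hle (Fin.mk_le_of_le_val (Nat.zero_le _))
      rw [Equiv.symm_apply_eq] at h1
      exact disjoint_left.1 (A.disjoint i l hil) hmem (h1 ▸ ha)
    have hcard : ∀ q, (A.bundle q).card ≤ 2 := by
      intro q
      rcases (A.bundle q).eq_empty_or_nonempty with he | ⟨g, hg⟩
      · simp [he]
      · have h1 := (hA i q g hg).card_le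
        rw [card_erase_of_mem hg, hsingle, card_singleton] at h1
        omega
    have hcover : m ≤ ∑ q, (A.bundle q).card := by
      have h1 : (univ : Finset (Fin m)) ⊆ univ.biUnion A.bundle := fun g _ => by
        obtain ⟨q, hq⟩ := A.cover g
        exact mem_biUnion.2 ⟨q, mem_univ _, hq⟩
      have h2 := (card_le_card h1).trans card_biUnion_le
      rwa [card_univ, Fintype.card_fin] at h2
    have hsum : ∑ q, (A.bundle q).card < ∑ q : Fin n, 2 :=
      sum_lt_sum (fun q _ => hcard q) ⟨i, mem_univ _, by rw [hsingle, card_singleton]; norm_num⟩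
    rw [sum_const, card_univ, Fintype.card_fin, smul_eq_mul] at hsum
    omega
  simp only [Function.Injective, not_forall] at h
  obtain ⟨i, l, he, hil⟩ := h
  obtain ⟨q, hq⟩ := A.cover (π i ⟨0, h0⟩)
  by_cases hqi : q = i
  · subst hqi
    exact hlt q l hil (he ▸ hq)
  · exact hlt q i hqi hq

end Impossibility

end FairDivision

theorem theorem4 :
    -- Round-Robin is SD-EF (in particular EF) when `n` divides `m`
    (∃ C : ℝ, 0 < C ∧
      ∀ (n m : ℕ) [NeZero n], 2 ≤ n → 0 < m → n ∣ m →
      ∀ (v : Fin n → BundleValuation m) (σ : Fin n → ItemOrder m),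
        (∀ i, OrderConsistentWith (σ i) (v i)) →
        1 - C * ((n : ℝ) ^ 2 / m + n * Real.log m / (m : ℝ) ^ (((n : ℝ) - 1) / n)) ≤
          renamingProb n m (fun ρ =>
            (roundRobin (fun i => renameOrdering (ρ i) (σ i))).IsSDEF
              (fun i => renameOrdering (ρ i) (σ i)) ∧
            (roundRobin (fun i => renameOrdering (ρ i) (σ i))).IsEF
              (fun i => rename (ρ i) (v i)))) ∧
    -- Round-Robin is SD-EFX (in particular EFX) for every `m`
    (∃ C : ℝ, 0 < C ∧
      ∀ (n m : ℕ) [NeZero n], 2 ≤ n → 0 < m →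
      ∀ (v : Fin n → BundleValuation m) (σ : Fin n → ItemOrder m),
        (∀ i, OrderConsistentWith (σ i) (v i)) →
        1 - C * ((n : ℝ) ^ 2 / m) ≤
          renamingProb n m (fun ρ =>
            (roundRobin (fun i => renameOrdering (ρ i) (σ i))).IsSDEFX
              (fun i => renameOrdering (ρ i) (σ i)) ∧
            (roundRobin (fun i => renameOrdering (ρ i) (σ i))).IsEFX
              (fun i => rename (ρ i) (v i)))) ∧
    (∃ c : ℝ, 0 < c ∧
      ∀ n m : ℕ, 2 ≤ n → 2 * n ≤ m →
        -- there need not be an EF allocation, whatever unit-demand valuations the agents have,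
        -- as long as each of them has a unique most valuable item
        (∀ w : Fin n → Fin m → ℝ,
          (∀ i g, 0 ≤ w i g) →
          (∀ i, ∃ g, ∀ g', g' ≠ g → w i g' < w i g) →
          (∀ i, OrderConsistent (unitDemand (w i))) ∧
          c * min ((n : ℝ) ^ 2 / m) 1 ≤
            renamingProb n m (fun ρ =>
              ¬ ∃ A : Allocation n m, A.IsEF (fun i => rename (ρ i) (unitDemand (w i))))) ∧
        -- there need not be an SD-EFX allocation, whatever the original orderings are
        (∀ σ : Fin n → ItemOrder m,
          c * min ((n : ℝ) ^ 2 / m) 1 ≤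
            renamingProb n m (fun ρ =>
              ¬ ∃ A : Allocation n m, A.IsSDEFX (fun i => renameOrdering (ρ i) (σ i))))) := by
  refine ⟨⟨1010, by norm_num, fun n m _ hn hm hdvd v σ hv => le_renamingProb_isSDEF hn hm hdvd v σ hv⟩,
    ⟨1000, by norm_num, fun n m _ hn hm v σ hv => le_renamingProb_isSDEFX hn hm v σ hv⟩,
    ⟨1 / 5, by norm_num, fun n m hn hm => ⟨fun w hw hw' => ⟨fun i => ?_, ?_⟩, fun σ => ?_⟩⟩⟩
  · exact orderConsistent_unitDemand (hw i)
  · choose a ha using hw'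
    refine (min_le_renamingProb_not_injective hn (by omega) a).trans (renamingProb_mono fun ρ h => ?_)
    exact not_exists_isEF_of_not_injective (by omega) hw ha h
  · have h0 : 0 < m := by omega
    refine (min_le_renamingProb_not_injective hn (by omega) fun i => σ i ⟨0, h0⟩).trans
      (renamingProb_mono fun ρ h => ?_)
    exact not_exists_isSDEFX_of_not_injective hm h0 h
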